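/- Let $M$ be a smooth finite-dimensional Hausdorff manifold without boundary, $E\to M$ a smooth real vector bundle of finite rank, $\pi:A\to M$ a smooth affine bundle modelled on $E$, and $f:A\to\mathbb R$ a smooth function. For $a\in A_x$ let $\mathrm{vl}_a:E_x\to V_aA=\operatorname{Ker}T_a\pi$ be the vertical lift, i.e. the isomorphism sending $e$ to the velocity at $t=0$ of $t\mapsto a+te$. Let $\mathcal F=Df:A\to E^*$ be the fibre derivative of $f$, where $\mathcal F(a)\in E_x^*$ is the derivative at $a$ of $f|_{A_x}$. Let $D^2f(a)=D(\mathcal F|_{A_x})(a):E_x\to E_x^*$ be the fibre hessian, and let $\widehat{\mathcal W}_a:V_aA\to V_a^*A$ be the linear map with $\langle\widehat{\mathcal W}_a(\mathrm{vl}_a e),\mathrm{vl}_a e'\rangle=D^2f(a)(e)(e')$. For a smooth real function $h$ on an open subset of $E^*$, let $\Gamma_h(a)=\mathrm{vl}_a\big(\gamma_h(a)\big)$, where $\gamma_h(a)\in E_x\cong E_x^{**}$ is the derivative of $h|_{E_x^*}$ at $\mathcal F(a)$. Suppose that $f$ is almost regular: $\mathcal F$ has connected fibres, and its image $\mathcal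 F(A)$ is a closed embedded submanifold of $E^*$ onto which $\mathcal F$ is a submersion. Then: 1. $\operatorname{Ker}\widehat{\mathcal W}_a=\operatorname{Ker}T_a\mathcal F$ for every $a\in A$. 2. $\mathcal F(A)$ is locally defined by the vanishing of independent functions: every $p\in\mathcal F(A)$ has an open neighbourhood $U\subset E^*$ for which there are finitely many smooth functions $\phi_1,\dots,\phi_k:E^*\to\mathbb R$ whose differentials are linearly independent at every point of $U$ and such that $\mathcal F(A)\cap U=\{q\in U:\phi_1(q)=\dots=\phi_k(q)=0\}$. 3. Let $U\subset E^*$ be any open set and let $\phi_1,\dots,\phi_k$ be any smooth functions on $U$ such that $\mathcal F(A)\cap U$ is the set of their common zeros in $U$ and their differentials are linearly independent at every point of $\mathcal F(A)\cap U$. Then the vertical vector fields $\Gamma_{\phi_1},\dots,\Gamma_{\phi_k}$ form a frame of $\operatorname{Ker}\widehat{\mathcal W}=\operatorname{Ker}T\mathcal F$ on $\mathcal F^{-1}(U)$: they are smooth there, and at every $a\in\mathcal F^{-1}(U)$ their values are a basis of $\operatorname{Ker}\widehat{\mathcal W}_a=\operatorname{Ker}T_a\mathcal F$. -/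

import Mathlib

open scoped Manifold ContDiff Topology
open Bundle

noncomputable section

namespace FibreDerivative

/-! ### Affine bundles -/

section Bundles

variable {EB HB M EA HA : Type*} (F : Type*) (E A : M → Type*)
  [NormedAddCommGroup EB] [NormedSpace ℝ EB] [TopologicalSpace HB]
  (IB : ModelWithCorners ℝ EB HB) [TopologicalSpace M] [ChartedSpace HB M]
  [NormedAddCommGroup F] [NormedSpace ℝ F]
  [∀ x, AddCommGroup (E x)] [∀ x, Module ℝ (E x)] [∀ x, TopologicalSpace (E x)]
  [TopologicalSpace (TotalSpace F E)] [FiberBundle F E]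
  [NormedAddCommGroup EA] [NormedSpace ℝ EA] [TopologicalSpace HA]
  (IA : ModelWithCorners ℝ EA HA)
  [TopologicalSpace (TotalSpace F A)] [ChartedSpace HA (TotalSpace F A)]
  [∀ x, AddTorsor (E x) (A x)]

/-- A smooth affine bundle `A → M` modelled on the vector bundle `E → M` with typical fibre `F`.
The total space of `A` is a manifold, every fibre `A x` is an affine space over `E x`, and, over
the members of an open cover of `M`, there is a section `s` of `A` for which
`E|_U → A|_U`, `v ↦ v + s`, is a diffeomorphism, with inverse `a ↦ a - s`. -/
class SmoothAffineBundle : Prop where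
  contMDiff_proj : ContMDiff IA IB ∞ (π F A)
  exists_section : ∀ x : M, ∃ U : Set M, IsOpen U ∧ x ∈ U ∧ ∃ s : ∀ y, A y,
    ContMDiffOn (IB.prod 𝓘(ℝ, F)) IA ∞
      (fun v : TotalSpace F E => (⟨v.1, v.2 +ᵥ s v.1⟩ : TotalSpace F A)) (π F E ⁻¹' U) ∧
    ContMDiffOn IA (IB.prod 𝓘(ℝ, F)) ∞
      (fun a : TotalSpace F A => (⟨a.1, a.2 -ᵥ s a.1⟩ : TotalSpace F E)) (π F A ⁻¹' U)

end Bundles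

/-! ### The vertical bundle and the vertical lift -/

section Vertical

variable {EB HB M EA HA F : Type*} {E A : M → Type*}
  [NormedAddCommGroup EB] [NormedSpace ℝ EB] [TopologicalSpace HB]
  (IB : ModelWithCorners ℝ EB HB) [TopologicalSpace M] [ChartedSpace HB M]
  [NormedAddCommGroup F] [NormedSpace ℝ F]
  [∀ x, AddCommGroup (E x)] [∀ x, Module ℝ (E x)] [∀ x, TopologicalSpace (E x)]
  [TopologicalSpace (TotalSpace F E)] [FiberBundle F E] [VectorBundle ℝ F E]
  [NormedAddCommGroup EA] [NormedSpace ℝ EA] [TopologicalSpace HA]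
  (IA : ModelWithCorners ℝ EA HA)
  [TopologicalSpace (TotalSpace F A)] [ChartedSpace HA (TotalSpace F A)]
  [∀ x, AddTorsor (E x) (A x)]

/-- The vertical space `V_a A = Ker T_a π`. -/
def verticalSpace (a : TotalSpace F A) : Submodule ℝ (TangentSpace IA a) :=
  LinearMap.ker (mfderiv IA IB (π F A) a).toLinearMap

/-- The straight line `t ↦ a + t e` in the fibre of `a`. -/
def fibreLine (a : TotalSpace F A) (e : E a.1) (t : ℝ) : TotalSpace F A := ⟨a.1, t • e +ᵥ a.2⟩

/-- The velocity at `t = 0` of the line `t ↦ a + t e`. -/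
def lineVelocity (a : TotalSpace F A) (e : E a.1) : TangentSpace IA a :=
  mfderiv 𝓘(ℝ, ℝ) IA (fibreLine a e) 0 (1 : ℝ)

/-- Charts of `A` near `a` and of the fibre through `a`, both coming from a local section and from
a local trivialization of `E`. -/
theorem exists_fibre_chart [ContMDiffVectorBundle ∞ F E IB] [SmoothAffineBundle F E A IB IA]
    (a : TotalSpace F A) :
    ∃ (L : E a.1 ≃ₗ[ℝ] F) (v₀ : F) (H : M × F → TotalSpace F A) (R : TotalSpace F A → F),
      (∀ e : E a.1, ∀ t : ℝ, fibreLine a e t = H (a.1, v₀ + t • L e)) ∧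
      H (a.1, v₀) = a ∧ R a = v₀ ∧
      MDifferentiableAt (IB.prod 𝓘(ℝ, F)) IA H (a.1, v₀) ∧
      MDifferentiableAt IA 𝓘(ℝ, F) R a ∧
      (∀ v, R (H (a.1, v)) = v) ∧ (∀ v, (H (a.1, v)).1 = a.1) ∧
      (∀ᶠ b in 𝓝 a, H (b.1, R b) = b) := by
  obtain ⟨U, hU, haU, s, hΨ, hΘ⟩ :=
    SmoothAffineBundle.exists_section (F := F) (E := E) (A := A) (IB := IB) (IA := IA) a.1
  have hπ : Continuous (π F A) :=
    (SmoothAffineBundle.contMDiff_proj (F := F) (E := E) (A := A) (IB := IB) (IA := IA)).continuous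
  set e := trivializationAt F E a.1 with he
  have hx : a.1 ∈ e.baseSet := mem_baseSet_trivializationAt F E a.1
  let Ψ : TotalSpace F E → TotalSpace F A := fun v => ⟨v.1, v.2 +ᵥ s v.1⟩
  let Θ : TotalSpace F A → TotalSpace F E := fun b => ⟨b.1, b.2 -ᵥ s b.1⟩
  have hΘΨ : ∀ z, Θ (Ψ z) = z := fun z => by simp [Θ, Ψ]
  have hΨΘ : ∀ z, Ψ (Θ z) = z := fun z => by simp [Θ, Ψ]
  let L : E a.1 ≃ₗ[ℝ] F := (e.continuousLinearEquivAt ℝ a.1 hx).toLinearEquiv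
  have heL : ∀ w : E a.1, e ⟨a.1, w⟩ = (a.1, L w) := fun w =>
    e.apply_eq_prod_continuousLinearEquivAt ℝ a.1 hx w
  have hsymm : ∀ w : E a.1, e.toOpenPartialHomeomorph.symm (a.1, L w) = ⟨a.1, w⟩ := fun w => by
    rw [← heL w]
    exact e.toOpenPartialHomeomorph.left_inv (e.mem_source.2 hx)
  have hΨa : ContMDiffAt (IB.prod 𝓘(ℝ, F)) IA ∞ Ψ (Θ a) :=
    hΨ.contMDiffAt ((hU.preimage (FiberBundle.continuous_proj F E)).mem_nhds haU)
  have hΘa : ContMDiffAt IA (IB.prod 𝓘(ℝ, F)) ∞ Θ a :=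
    hΘ.contMDiffAt ((hU.preimage hπ).mem_nhds haU)
  have hes : e.toOpenPartialHomeomorph.symm (a.1, L (a.2 -ᵥ s a.1)) = Θ a := hsymm _
  refine ⟨L, L (a.2 -ᵥ s a.1), fun z => Ψ (e.toOpenPartialHomeomorph.symm z),
    fun b => (e (Θ b)).2, ?_, ?_, ?_, ?_, ?_, ?_, ?_, ?_⟩
  · intro w t
    beta_reduce
    rw [← map_smul, ← map_add, hsymm]
    simp [Ψ, fibreLine, add_comm (a.2 -ᵥ s a.1), add_vadd]
  · beta_reduce
    rw [hes, hΨΘ]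
  · change (e ⟨a.1, a.2 -ᵥ s a.1⟩).2 = _
    rw [heL]
  · have h1 : ContMDiffAt (IB.prod 𝓘(ℝ, F)) (IB.prod 𝓘(ℝ, F)) ∞
        e.toOpenPartialHomeomorph.symm (a.1, L (a.2 -ᵥ s a.1)) :=
      (e.contMDiffOn_symm (IB := IB) (n := ∞)).contMDiffAt
        (e.open_target.mem_nhds (e.mem_target.2 hx))
    rw [← hes] at hΨa
    exact (hΨa.comp _ h1).mdifferentiableAt (by simp)
  · have h1 : ContMDiffAt (IB.prod 𝓘(ℝ, F)) (IB.prod 𝓘(ℝ, F)) ∞ e (Θ a) :=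
      (e.contMDiffOn (IB := IB) (n := ∞)).contMDiffAt
        (e.open_source.mem_nhds (e.mem_source.2 hx))
    exact (contMDiffAt_snd.comp _ (h1.comp _ hΘa)).mdifferentiableAt (by simp)
  · intro v
    obtain ⟨w, rfl⟩ := L.surjective v
    simp only [hsymm, hΘΨ, heL]
  · intro v
    obtain ⟨w, rfl⟩ := L.surjective v
    simp only [hsymm, Ψ]
  · filter_upwards [(e.open_baseSet.preimage hπ).mem_nhds hx] with b hb
    have h1 : e (Θ b) = (b.1, (e (Θ b)).2) := Prod.ext (e.coe_fst' hb) rfl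
    have h2 : Θ b ∈ e.source := e.mem_source.2 hb
    have h3 : e.toOpenPartialHomeomorph.symm (e (Θ b)) = Θ b :=
      e.toOpenPartialHomeomorph.left_inv h2
    rw [← h1, h3, hΨΘ]

/-- The velocity of `t ↦ a + t e` depends linearly and injectively on `e`, and these velocities
are the vertical vectors at `a`. -/
theorem exists_linear_lineVelocity [ContMDiffVectorBundle ∞ F E IB]
    [SmoothAffineBundle F E A IB IA] (a : TotalSpace F A) :
    ∃ l : E a.1 →ₗ[ℝ] TangentSpace IA a, (∀ e, l e = lineVelocity IA a e) ∧
      Function.Injective l ∧ LinearMap.range l = verticalSpace IB IA a := by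
  obtain ⟨L, v₀, H, R, hline, hHa, hRa, hH, hR, hRH, hH1, hHR⟩ :=
    exists_fibre_chart (E := E) IB IA a
  have hπ : MDifferentiableAt IA IB (π F A) a :=
    (SmoothAffineBundle.contMDiff_proj (F := F) (E := E) (A := A) (IB := IB)
      (IA := IA)).mdifferentiable (by simp) a
  -- the chart of the fibre
  let G : F → TotalSpace F A := fun v => H (a.1, v)
  have hGa : G v₀ = a := hHa
  have hι : HasMFDerivAt 𝓘(ℝ, F) (IB.prod 𝓘(ℝ, F)) (fun v : F => (a.1, v)) v₀
      (ContinuousLinearMap.inr ℝ EB F) :=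
    (hasMFDerivAt_const a.1 v₀).prodMk (hasMFDerivAt_id v₀)
  let T : EB × F →L[ℝ] EA := mfderiv (IB.prod 𝓘(ℝ, F)) IA H (a.1, v₀)
  have hG : HasMFDerivAt 𝓘(ℝ, F) IA G v₀ (T.comp (ContinuousLinearMap.inr ℝ EB F)) :=
    hH.hasMFDerivAt.comp v₀ hι
  let dR : EA →L[ℝ] F := mfderiv IA 𝓘(ℝ, F) R a
  let dπ : EA →L[ℝ] EB := mfderiv IA IB (π F A) a
  have hRd : HasMFDerivAt IA 𝓘(ℝ, F) R (G v₀) dR := by rw [hGa]; exact hR.hasMFDerivAt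
  have hπd : HasMFDerivAt IA IB (π F A) (G v₀) dπ := by rw [hGa]; exact hπ.hasMFDerivAt
  have hvel : ∀ e : E a.1, lineVelocity IA a e = T (0, L e) := by
    intro e
    have h1 : HasFDerivAt (fun t : ℝ => v₀ + t • L e)
        ((ContinuousLinearMap.id ℝ ℝ).smulRight (L e)) 0 :=
      ((hasFDerivAt_id (0 : ℝ)).smul_const (L e)).const_add v₀
    have h2 : HasMFDerivAt 𝓘(ℝ, F) IA G (v₀ + (0 : ℝ) • L e)
        (T.comp (ContinuousLinearMap.inr ℝ EB F)) := by
      rw [zero_smul, add_zero]; exact hG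
    have h3 := h2.comp 0 h1.hasMFDerivAt
    have h4 : G ∘ (fun t : ℝ => v₀ + t • L e) = fibreLine a e :=
      funext fun t => (hline e t).symm
    rw [h4] at h3
    have h5 : lineVelocity IA a e = T (0, (1 : ℝ) • L e) :=
      congrArg (fun l : ℝ →L[ℝ] EA => l 1) h3.mfderiv
    rw [h5, one_smul]
  have hRG : ∀ v : F, dR (T (0, v)) = v := by
    intro v
    have h1 := hRd.comp v₀ hG
    have h2 : R ∘ G = id := funext hRH
    rw [h2] at h1
    have h3 := hasMFDerivAt_unique h1 (hasMFDerivAt_id v₀)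
    exact congrArg (fun l : F →L[ℝ] F => l v) h3
  have hπG : ∀ v : F, dπ (T (0, v)) = 0 := by
    intro v
    have h1 := hπd.comp v₀ hG
    have h2 : π F A ∘ G = fun _ => a.1 := funext hH1
    rw [h2] at h1
    have h3 := hasMFDerivAt_unique h1 (hasMFDerivAt_const a.1 v₀)
    exact congrArg (fun l : F →L[ℝ] EB => l v) h3
  have hTR : ∀ w : EA, T (dπ w, dR w) = w := by
    intro w
    have h1 : HasMFDerivAt IA (IB.prod 𝓘(ℝ, F)) (fun b : TotalSpace F A => (b.1, R b)) a
        (dπ.prod dR) := hπ.hasMFDerivAt.prodMk hR.hasMFDerivAt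
    have h2 : HasMFDerivAt (IB.prod 𝓘(ℝ, F)) IA H (a.1, R a) T := by
      rw [hRa]; exact hH.hasMFDerivAt
    have h3 := (h2.comp a h1)
    have h4 := h3.congr_of_eventuallyEq (f₁ := id) (hHR.mono fun b hb => hb.symm)
    have h5 := hasMFDerivAt_unique h4 (hasMFDerivAt_id a)
    exact congrArg (fun l : EA →L[ℝ] EA => l w) h5
  let l : E a.1 →ₗ[ℝ] EA := (T.comp (ContinuousLinearMap.inr ℝ EB F)).toLinearMap ∘ₗ L.toLinearMap
  have hl : ∀ e, l e = T (0, L e) := fun e => rfl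
  refine ⟨l, fun e => (hvel e).symm, ?_, ?_⟩
  · intro e e' h
    have h' : l e = l e' := h
    rw [hl, hl] at h'
    have := congrArg dR h'
    rw [hRG, hRG] at this
    exact L.injective this
  · refine le_antisymm ?_ ?_
    · rintro _ ⟨e, rfl⟩
      exact hπG (L e)
    · intro w hw
      have hw' : dπ w = 0 := hw
      refine ⟨L.symm (dR w), ?_⟩
      have h1 := hTR w
      rw [hw'] at h1
      exact (congrArg (fun v => T (0, v)) (L.apply_symm_apply (dR w))).trans h1

/-- The vertical lift `vl_A(a, ·) : E_x ≅ V_a A`, for `a` in the fibre of `x`: it sends `e` to the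
velocity at `t = 0` of the line `t ↦ a + t e`. -/
def vertLift [ContMDiffVectorBundle ∞ F E IB] [SmoothAffineBundle F E A IB IA]
    (a : TotalSpace F A) : E a.1 ≃ₗ[ℝ] verticalSpace IB IA a :=
  let h := (exists_linear_lineVelocity (E := E) IB IA a).choose_spec
  (LinearEquiv.ofInjective _ h.2.1).trans (LinearEquiv.ofEq _ _ h.2.2)

theorem vertLift_apply [ContMDiffVectorBundle ∞ F E IB] [SmoothAffineBundle F E A IB IA]
    (a : TotalSpace F A) (e : E a.1) :
    (vertLift IB IA a e : TangentSpace IA a) = lineVelocity IA a e :=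
  (exists_linear_lineVelocity (E := E) IB IA a).choose_spec.1 e

end Vertical

/-! ### Fibre derivatives -/

/-- The ordinary derivative, at `p`, of a map between affine spaces over topological vector
spaces, as a continuous linear map between the modelling vector spaces. -/
def affineDeriv {V W P Q : Type*} [AddCommGroup V] [Module ℝ V] [TopologicalSpace V]
    [AddCommGroup W] [Module ℝ W] [TopologicalSpace W] [AddTorsor V P] [AddTorsor W Q]
    (g : P → Q) (p : P) : V →L[ℝ] W :=
  fderiv ℝ (fun v : V => g (v +ᵥ p) -ᵥ g p) 0

section Derivatives

variable {EB HB M EA HA F : Type*} {E A : M → Type*}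
  [NormedAddCommGroup EB] [NormedSpace ℝ EB] [TopologicalSpace HB]
  (IB : ModelWithCorners ℝ EB HB) [TopologicalSpace M] [ChartedSpace HB M]
  [NormedAddCommGroup F] [NormedSpace ℝ F]
  [∀ x, AddCommGroup (E x)] [∀ x, Module ℝ (E x)] [∀ x, TopologicalSpace (E x)]
  [TopologicalSpace (TotalSpace F E)] [FiberBundle F E] [VectorBundle ℝ F E]
  [NormedAddCommGroup EA] [NormedSpace ℝ EA] [TopologicalSpace HA]
  (IA : ModelWithCorners ℝ EA HA)
  [TopologicalSpace (TotalSpace F A)] [ChartedSpace HA (TotalSpace F A)]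
  [∀ x, AddTorsor (E x) (A x)]

variable (F E) in
/-- The total space of the dual bundle `E^* = Hom(E, M × ℝ)`. -/
abbrev DualSpace : Type _ :=
  TotalSpace (F →L[ℝ] ℝ) (fun x : M => E x →L[ℝ] Trivial M ℝ x)

/-- The fibre derivative `𝓕 = D f : A → E^*` of a function `f : A → ℝ`. -/
def fibreDeriv (f : TotalSpace F A → ℝ) (a : TotalSpace F A) : DualSpace F E :=
  ⟨a.1, (affineDeriv (fun b : A a.1 => f ⟨a.1, b⟩) a.2 : E a.1 →L[ℝ] ℝ)⟩

/-- The fibre hessian `D² f = D 𝓕` at `a`. -/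
def fibreHessian (f : TotalSpace F A → ℝ) (a : TotalSpace F A) :
    E a.1 →L[ℝ] (E a.1 →L[ℝ] ℝ) :=
  let g : A a.1 → (E a.1 →L[ℝ] ℝ) := fun b => (fibreDeriv (E := E) f ⟨a.1, b⟩).2
  affineDeriv g a.2

/-- The fibres of a vector bundle of finite rank are finite-dimensional Hausdorff topological
vector spaces. -/
theorem finiteDimensional_fibre (F : Type*) (E : M → Type*)
    [NormedAddCommGroup F] [NormedSpace ℝ F] [FiniteDimensional ℝ F]
    [∀ x, AddCommGroup (E x)] [∀ x, Module ℝ (E x)] [∀ x, TopologicalSpace (E x)]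
    [TopologicalSpace (TotalSpace F E)] [FiberBundle F E] [VectorBundle ℝ F E] (x : M) :
    FiniteDimensional ℝ (E x) ∧ T2Space (E x) ∧ IsTopologicalAddGroup (E x) ∧
      ContinuousSMul ℝ (E x) :=
  let L := (trivializationAt F E x).continuousLinearEquivAt ℝ x
    (mem_baseSet_trivializationAt F E x)
  ⟨L.symm.toLinearEquiv.finiteDimensional, L.toHomeomorph.symm.t2Space,
    L.toHomeomorph.isInducing.topologicalAddGroup L.toLinearMap,
    L.toHomeomorph.isInducing.continuousSMul continuous_id (fun {c v} => L.map_smul c v)⟩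

variable (F E) in
/-- The canonical isomorphism `E_x ≅ E_x^{**}`, which sends `e` to the evaluation `α ↦ α e`. -/
def bidualEquiv [FiniteDimensional ℝ F] (x : M) :
    E x ≃ₗ[ℝ] Module.Dual ℝ (E x →L[ℝ] ℝ) :=
  haveI := (finiteDimensional_fibre F E x).1
  haveI := (finiteDimensional_fibre F E x).2.1
  haveI := (finiteDimensional_fibre F E x).2.2.1
  haveI := (finiteDimensional_fibre F E x).2.2.2
  (Module.evalEquiv ℝ (E x)).trans
    (LinearMap.toContinuousLinearMap (𝕜 := ℝ) (E := E x) (F' := ℝ)).symm.dualMap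

theorem bidualEquiv_apply [FiniteDimensional ℝ F] (x : M) (e : E x) (α : E x →L[ℝ] ℝ) :
    bidualEquiv F E x e α = α e := rfl

/-- For `h : E^* → ℝ`, the map `γ_h = D h ∘ 𝓕 : A → E^{**} ≅ E`. -/
def gammaMap [FiniteDimensional ℝ F] (f : TotalSpace F A → ℝ) (h : DualSpace F E → ℝ)
    (a : TotalSpace F A) : E a.1 :=
  let hx : (E a.1 →L[ℝ] ℝ) → ℝ := fun α => h ⟨a.1, α⟩
  let Dh : (E a.1 →L[ℝ] ℝ) →L[ℝ] ℝ := affineDeriv hx (fibreDeriv f a).2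
  (bidualEquiv F E a.1).symm Dh.toLinearMap

/-- The vertical vector field `Γ_h = vl_A ∘ (Id_A, γ_h)` on `A`. -/
def gammaField [FiniteDimensional ℝ F] [ContMDiffVectorBundle ∞ F E IB]
    [SmoothAffineBundle F E A IB IA] (f : TotalSpace F A → ℝ) (h : DualSpace F E → ℝ)
    (a : TotalSpace F A) : TangentSpace IA a :=
  (vertLift IB IA a (gammaMap f h a) : TangentSpace IA a)

/-- The operator `Ŵ_a : V_a A → V_a^* A` obtained from the fibre hessian of `f` through the
vertical lift: `Ŵ_a (vl e) (vl e') = D² f(a)(e)(e')`. -/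
def hessianOp [ContMDiffVectorBundle ∞ F E IB] [SmoothAffineBundle F E A IB IA]
    (f : TotalSpace F A → ℝ) (a : TotalSpace F A) :
    verticalSpace IB IA a →ₗ[ℝ] Module.Dual ℝ (verticalSpace IB IA a) :=
  (vertLift IB IA a).symm.toLinearMap.dualMap ∘ₗ ContinuousLinearMap.coeLM ℝ ∘ₗ
    (fibreHessian f a).toLinearMap ∘ₗ (vertLift IB IA a).symm.toLinearMap

theorem hessianOp_apply [ContMDiffVectorBundle ∞ F E IB] [SmoothAffineBundle F E A IB IA]
    (f : TotalSpace F A → ℝ) (a : TotalSpace F A) (v w : verticalSpace IB IA a) :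
    hessianOp IB IA f a v w =
      fibreHessian f a ((vertLift IB IA a).symm v) ((vertLift IB IA a).symm w) := rfl

/-- `Ker Ŵ_a`, as a space of tangent vectors of `A` at `a`. -/
def kerHessianOp [ContMDiffVectorBundle ∞ F E IB] [SmoothAffineBundle F E A IB IA]
    (f : TotalSpace F A → ℝ) (a : TotalSpace F A) : Submodule ℝ (TangentSpace IA a) :=
  (LinearMap.ker (hessianOp IB IA f a)).map (verticalSpace IB IA a).subtype

/-- `Ker T_a 𝓕`. -/
def kerTangentFibreDeriv (f : TotalSpace F A → ℝ) (a : TotalSpace F A) :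
    Submodule ℝ (TangentSpace IA a) :=
  LinearMap.ker (mfderiv IA (IB.prod 𝓘(ℝ, F →L[ℝ] ℝ)) (fibreDeriv (E := E) f) a).toLinearMap

end Derivatives

/-! ### Submanifolds, defining functions, frames -/

section Manifolds

variable {EX HX X EY HY Y : Type*}
  [NormedAddCommGroup EX] [NormedSpace ℝ EX] [TopologicalSpace HX]
  (I : ModelWithCorners ℝ EX HX) [TopologicalSpace X] [ChartedSpace HX X]
  [NormedAddCommGroup EY] [NormedSpace ℝ EY] [TopologicalSpace HY]
  (J : ModelWithCorners ℝ EY HY) [TopologicalSpace Y] [ChartedSpace HY Y]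

/-- `g : X → Y` is a submersion onto a closed submanifold: its image is closed, and, with the
topology induced by `Y`, it carries a manifold structure for which the inclusion in `Y` is a
smooth embedding and `g`, as a map onto its image, is a submersion. -/
def IsSubmersionOntoClosedSubmanifold (g : X → Y) : Prop :=
  IsClosed (Set.range g) ∧
    ∃ (d : ℕ) (_ : ChartedSpace (EuclideanSpace ℝ (Fin d)) (Set.range g)),
      IsManifold (𝓡 d) ∞ (Set.range g) ∧
      Manifold.IsSmoothEmbedding (𝓡 d) J ∞ (Subtype.val : Set.range g → Y) ∧
      Manifold.IsSubmersion I (𝓡 d) ∞ (Set.rangeFactorization g)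

/-- The functions `φ μ` define the subset `S` on the open set `U`: they are smooth on `U`,
`S ∩ U` is the set of their common zeros in `U`, and their differentials are linearly independent
at every point of `S ∩ U`. -/
structure DefinesOn {k : ℕ} (φ : Fin k → Y → ℝ) (S U : Set Y) : Prop where
  isOpen : IsOpen U
  contMDiffOn : ∀ μ, ContMDiffOn J 𝓘(ℝ, ℝ) ∞ (φ μ) U
  inter_eq : S ∩ U = {p ∈ U | ∀ μ, φ μ p = 0}
  linearIndependent : ∀ p ∈ S ∩ U, LinearIndependent ℝ fun μ => mvfderiv J (φ μ) p

/-- The vector fields `Γ μ` constitute a frame, on `U`, of the family `K` of subspaces of the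
tangent spaces: they are smooth on `U` and their values at every point of `U` are a basis of the
subspace at that point. -/
structure IsFrameOn [IsManifold I ∞ X] {k : ℕ} (Γ : Fin k → ∀ a : X, TangentSpace I a)
    (K : ∀ a : X, Submodule ℝ (TangentSpace I a)) (U : Set X) : Prop where
  contMDiffOn : ∀ μ, ContMDiffOn I I.tangent ∞ (fun a => (⟨a, Γ μ a⟩ : TangentBundle I X)) U
  linearIndependent : ∀ a ∈ U, LinearIndependent ℝ fun μ => Γ μ a
  span_eq : ∀ a ∈ U, Submodule.span ℝ (Set.range fun μ => Γ μ a) = K a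

end Manifolds

section AlmostRegular

variable {EB HB M EA HA F : Type*} {E A : M → Type*}
  [NormedAddCommGroup EB] [NormedSpace ℝ EB] [TopologicalSpace HB]
  (IB : ModelWithCorners ℝ EB HB) [TopologicalSpace M] [ChartedSpace HB M]
  [NormedAddCommGroup F] [NormedSpace ℝ F]
  [∀ x, AddCommGroup (E x)] [∀ x, Module ℝ (E x)] [∀ x, TopologicalSpace (E x)]
  [TopologicalSpace (TotalSpace F E)] [FiberBundle F E] [VectorBundle ℝ F E]
  [NormedAddCommGroup EA] [NormedSpace ℝ EA] [TopologicalSpace HA]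
  (IA : ModelWithCorners ℝ EA HA)
  [TopologicalSpace (TotalSpace F A)] [ChartedSpace HA (TotalSpace F A)]
  [∀ x, AddTorsor (E x) (A x)]

variable (E) in
/-- `f : A → ℝ` is almost regular: its fibre derivative `𝓕` has connected fibres and is a
submersion onto a closed submanifold of `E^*`. -/
structure AlmostRegular (f : TotalSpace F A → ℝ) : Prop where
  isConnected_fibre : ∀ p ∈ Set.range (fibreDeriv (E := E) f),
    IsConnected (fibreDeriv (E := E) f ⁻¹' {p})
  isSubmersionOnto : IsSubmersionOntoClosedSubmanifold IA (IB.prod 𝓘(ℝ, F →L[ℝ] ℝ))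
    (fibreDeriv (E := E) f)

end AlmostRegular

end FibreDerivative

end

noncomputable section

namespace FibreDerivative

/-! ### Derivatives in the fibres, and curves in level sets -/

section Calculus

/-! In a fibre chart `𝓕` is `(x, v) ↦ (x, ∂f/∂v)`, so up to linear isomorphisms its tangent map is
`(u, v) ↦ (u, B u + D v)`, with `D` the fibre hessian (`exists_derivative_of_fibreDeriv`). A vector
in its kernel has `u = 0` and `D v = 0`: it is a vertical vector killed by the hessian. This
equality of kernels holds for every smooth `f`.

The local equations come from the normal form of an immersion: in adapted charts the image is a
slice, and the transverse coordinates vanish exactly on it (`exists_defining_submersion`). Bump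
functions make these coordinates global.

For the frame, let `l μ` be the differential of `φ μ` at `𝓕 a`. On a vertical vector `(0, β)` it
takes the value `β (γ μ)`. The `l μ` vanish on the range of `T𝓕`, and this range contains vectors
with every `u`; so a combination of the `l μ` that vanishes on vertical vectors vanishes everywhere,
and the `γ μ` inherit the independence of the `l μ`. Since `(0, D v)` lies in the range, `γ μ` pairs
to zero with all `D v`, and symmetry of `D` gives `D (γ μ) = 0`. Conversely, if `D w = 0`, symmetry
makes the form `(u, β) ↦ (β - B u) w` vanish on the range. The range contains the common kernel of
the `l μ` (`mem_range_of_mvfderiv_eq_zero`), so this form is a combination of the `l μ`, and its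
restriction to `u = 0` expresses `w` through the `γ μ`. The linear algebra is in
`linearIndependent_of_vertical` and `mem_span_iff_of_vertical`. Smoothness holds because `Γ_h` is
the velocity of a smooth family of lines. -/

theorem fderiv_transport_of_normed {V W F G : Type*} [NormedAddCommGroup V] [NormedSpace ℝ V]
    [NormedAddCommGroup W] [NormedSpace ℝ W]
    [NormedAddCommGroup F] [NormedSpace ℝ F] [NormedAddCommGroup G] [NormedSpace ℝ G]
    (L : V ≃L[ℝ] F) (N : W ≃L[ℝ] G) {g : V → W} {h : F → G} {h' : F →L[ℝ] G} {y c : _}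
    (hg : ∀ v, N (g v) = h (y + L v) - c) (hh : HasFDerivAt h h' y) (v : V) :
    N (fderiv ℝ g 0 v) = h' (L v) := by
  have h0 : HasFDerivAt h h' (y + L 0) := by simpa using hh
  have h1 : HasFDerivAt (fun v : V => h (y + L v) - c) (h' ∘L (L : V →L[ℝ] F)) 0 :=
    (h0.comp (0 : V) (L.hasFDerivAt.const_add y)).sub_const c
  have h2 : g = N.symm ∘ fun v : V => h (y + L v) - c := by
    funext v
    simp [← hg]
  rw [h2, (N.symm.hasFDerivAt.comp (0 : V) h1).fderiv]
  simp

/-- The derivative of a map between topological vector spaces which is conjugate, through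
continuous linear equivalences, to a differentiable map between normed spaces. -/
theorem fderiv_transport {V W F G : Type*} [AddCommGroup V] [Module ℝ V] [tV : TopologicalSpace V]
    [AddCommGroup W] [Module ℝ W] [tW : TopologicalSpace W]
    [NormedAddCommGroup F] [NormedSpace ℝ F] [NormedAddCommGroup G] [NormedSpace ℝ G]
    (L : V ≃L[ℝ] F) (N : W ≃L[ℝ] G) {g : V → W} {h : F → G} {h' : F →L[ℝ] G} {y c : _}
    (hg : ∀ v, N (g v) = h (y + L v) - c) (hh : HasFDerivAt h h' y) (v : V) :
    N (fderiv ℝ g 0 v) = h' (L v) := by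
  obtain ⟨L, hL1, hL2⟩ := L
  obtain ⟨N, hN1, hN2⟩ := N
  -- The fibres carry a topology but no norm. Once the topologies are replaced by the induced ones,
  -- the norms pulled back along `L` and `N` have exactly these topologies, and the normed case
  -- applies to the same `fderiv`.
  have hL : tV = TopologicalSpace.induced L inferInstance :=
    (Homeomorph.mk L.toEquiv hL1 hL2).isInducing.eq_induced
  have hN : tW = TopologicalSpace.induced N inferInstance :=
    (Homeomorph.mk N.toEquiv hN1 hN2).isInducing.eq_induced
  subst hL hN
  let nV := NormedAddCommGroup.induced V F L.toLinearMap L.injective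
  let := NormedSpace.induced ℝ V F L.toLinearMap
  let nW := NormedAddCommGroup.induced W G N.toLinearMap N.injective
  let := NormedSpace.induced ℝ W G N.toLinearMap
  exact fderiv_transport_of_normed (V := V) (W := W) ⟨L, hL1, hL2⟩ ⟨N, hN1, hN2⟩ hg hh v

theorem affineDeriv_transport {V W P Q F G : Type*} [AddCommGroup V] [Module ℝ V]
    [TopologicalSpace V] [AddCommGroup W] [Module ℝ W] [TopologicalSpace W]
    [AddTorsor V P] [AddTorsor W Q]
    [NormedAddCommGroup F] [NormedSpace ℝ F] [NormedAddCommGroup G] [NormedSpace ℝ G]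
    (L : V ≃L[ℝ] F) (N : W ≃L[ℝ] G) {g : P → Q} {p : P} {h : F → G} {h' : F →L[ℝ] G} {y c : _}
    (hg : ∀ v : V, N (g (v +ᵥ p) -ᵥ g p) = h (y + L v) - c) (hh : HasFDerivAt h h' y) (v : V) :
    N (affineDeriv (V := V) (W := W) g p v) = h' (L v) :=
  fderiv_transport L N hg hh v

/-- A vector killed by the surjective derivative of `Φ` at `p` is the velocity of a curve in the
level set of `Φ`. -/
theorem exists_curve_of_mem_ker {X Z : Type*} [NormedAddCommGroup X] [NormedSpace ℝ X]
    [FiniteDimensional ℝ X] [NormedAddCommGroup Z] [NormedSpace ℝ Z] [FiniteDimensional ℝ Z]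
    {Φ : X → Z} {Φ' : X →L[ℝ] Z} {p : X} (h : HasStrictFDerivAt Φ Φ' p)
    (hs : Function.Surjective Φ') {w : X} (hw : Φ' w = 0) :
    ∃ c : ℝ → X, c 0 = p ∧ HasDerivAt c w 0 ∧ ∀ᶠ t in 𝓝 0, Φ (c t) = Φ p := by
  have := FiniteDimensional.complete ℝ X
  have := FiniteDimensional.complete ℝ Z
  have hr : Φ'.range = ⊤ := LinearMap.range_eq_top.2 hs
  -- `i` parametrizes the level set through `p` by the kernel of `Φ'`, and its derivative at `0` is
  -- the inclusion of the kernel; the curve is the image of the line `t • w`.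
  let i := h.implicitFunction Φ Φ' hr (Φ p)
  let w' : Φ'.ker := ⟨w, hw⟩
  have hi : HasStrictFDerivAt i Φ'.ker.subtypeL ((0 : ℝ) • w') := by
    simpa using h.to_implicitFunction hr
  have hl : HasDerivAt (fun t : ℝ => t • w') w' 0 := by
    simpa using (hasDerivAt_id (0 : ℝ)).smul_const w'
  refine ⟨fun t => i (t • w'), ?_, ?_, ?_⟩
  · change i ((0 : ℝ) • w') = p
    rw [zero_smul]
    exact h.implicitFunction_apply_image hr
  · exact hi.hasFDerivAt.comp_hasDerivAt (0 : ℝ) hl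
  · have h1 := h.map_implicitFunction_eq hr
    have h2 : Filter.Tendsto (fun t : ℝ => (Φ p, t • w')) (𝓝 0) (𝓝 (Φ p, 0)) := by
      have : Continuous fun t : ℝ => (Φ p, t • w') := by fun_prop
      simpa using this.tendsto 0
    rw [nhds_prod_eq] at h2
    exact (h2.eventually (by simpa [nhds_prod_eq] using h1)).mono fun t ht => ht

end Calculus

/-! ### Derivatives read in charts -/

section Charts

variable {EY HY Y : Type*} [NormedAddCommGroup EY] [NormedSpace ℝ EY] [TopologicalSpace HY]
  {J : ModelWithCorners ℝ EY HY} [TopologicalSpace Y] [ChartedSpace HY Y]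

/-- The derivatives of maps which are locally inverse to each other. -/
theorem exists_hasMFDerivAt_of_local_inverse {EX HX X : Type*} [NormedAddCommGroup EX]
    [NormedSpace ℝ EX] [TopologicalSpace HX] {I : ModelWithCorners ℝ EX HX} [TopologicalSpace X]
    [ChartedSpace HX X] {g : X → Y} {h : Y → X} {x : X} {y : Y} (hgx : g x = y) (hhy : h y = x)
    (hg : MDifferentiableAt I J g x) (hh : MDifferentiableAt J I h y)
    (hhg : ∀ᶠ z in 𝓝 x, h (g z) = z) (hgh : ∀ᶠ z in 𝓝 y, g (h z) = z) :
    ∃ A : EX ≃L[ℝ] EY, HasMFDerivAt I J g x (A : EX →L[ℝ] EY) ∧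
      HasMFDerivAt J I h y (A.symm : EY →L[ℝ] EX) := by
  let B₁ : EX →L[ℝ] EY := mfderiv I J g x
  let B₂ : EY →L[ℝ] EX := mfderiv J I h y
  have hB₁ : HasMFDerivAt I J g x B₁ := hg.hasMFDerivAt
  have hB₂ : HasMFDerivAt J I h y B₂ := hh.hasMFDerivAt
  have h12 : B₁.comp B₂ = ContinuousLinearMap.id ℝ EY := by
    have hB₁' : HasMFDerivAt I J g (h y) B₁ := by rw [hhy]; exact hB₁
    exact hasMFDerivAt_unique (hB₁'.comp y hB₂) ((hasMFDerivAt_id y).congr_of_eventuallyEq hgh)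
  have h21 : B₂.comp B₁ = ContinuousLinearMap.id ℝ EX := by
    have hB₂' : HasMFDerivAt J I h (g x) B₂ := by rw [hgx]; exact hB₂
    exact hasMFDerivAt_unique (hB₂'.comp x hB₁) ((hasMFDerivAt_id x).congr_of_eventuallyEq hhg)
  exact ⟨ContinuousLinearEquiv.equivOfInverse B₁ B₂ (fun v => DFunLike.congr_fun h21 v)
    (fun v => DFunLike.congr_fun h12 v), hB₁, hB₂⟩

/-- The derivatives of an extended chart and of its inverse are inverse to each other. -/
theorem exists_hasMFDerivAt_extend [J.Boundaryless] {e : OpenPartialHomeomorph Y HY}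
    (he : e ∈ IsManifold.maximalAtlas J ∞ Y) {q : Y} (hq : q ∈ e.source) :
    ∃ A : EY ≃L[ℝ] EY, HasMFDerivAt J 𝓘(ℝ, EY) (e.extend J) q (A : EY →L[ℝ] EY) ∧
      HasMFDerivAt 𝓘(ℝ, EY) J (e.extend J).symm (e.extend J q) (A.symm : EY →L[ℝ] EY) := by
  have hq' : q ∈ (e.extend J).source := by rwa [e.extend_source]
  have hT : (e.extend J).target ∈ 𝓝 (e.extend J q) :=
    e.isOpen_extend_target.mem_nhds ((e.extend J).map_source hq')
  refine exists_hasMFDerivAt_of_local_inverse rfl ((e.extend J).left_inv hq')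
    ((e.contMDiffAt_extend he hq).mdifferentiableAt (by simp)) ?_ ?_ ?_
  · have := contMDiffOn_extend_symm he
    rw [← e.extend_target'] at this
    exact (this.contMDiffAt hT).mdifferentiableAt (by simp)
  · filter_upwards [e.open_source.mem_nhds hq] with y hy
    exact (e.extend J).left_inv (by rwa [e.extend_source])
  · filter_upwards [hT] with y hy
    exact (e.extend J).right_inv hy

/-- The derivatives of a map read in charts. -/
theorem comp_mfderiv_eq_of_eqOn {EX HX X : Type*} [NormedAddCommGroup EX] [NormedSpace ℝ EX]
    [TopologicalSpace HX] {I : ModelWithCorners ℝ EX HX} [I.Boundaryless] [TopologicalSpace X]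
    [ChartedSpace HX X] {g : X → Y} {g' : EX →L[ℝ] EY} {x : X} (hg : HasMFDerivAt I J g x g')
    {e : OpenPartialHomeomorph X HX} {A : EX ≃L[ℝ] EX} (hx : x ∈ e.source)
    (hA : HasMFDerivAt 𝓘(ℝ, EX) I (e.extend I).symm (e.extend I x) (A.symm : EX →L[ℝ] EX))
    {e' : OpenPartialHomeomorph Y HY} {A' : EY ≃L[ℝ] EY}
    (hA' : HasMFDerivAt J 𝓘(ℝ, EY) (e'.extend J) (g x) (A' : EY →L[ℝ] EY))
    {l : EX →L[ℝ] EY}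
    (heq : Set.EqOn (e'.extend J ∘ g ∘ (e.extend I).symm) l (e.extend I).target) (v : EX) :
    A' (g' (A.symm v)) = l v := by
  have hx' : x ∈ (e.extend I).source := by rwa [e.extend_source]
  have hleft : (e.extend I).symm (e.extend I x) = x := (e.extend I).left_inv hx'
  have hT : (e.extend I).target ∈ 𝓝 (e.extend I x) :=
    e.isOpen_extend_target.mem_nhds ((e.extend I).map_source hx')
  rw [← hleft] at hg
  have h1 := (hg.comp _ hA)
  have hA'' : HasMFDerivAt J 𝓘(ℝ, EY) (e'.extend J) ((g ∘ (e.extend I).symm) (e.extend I x))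
      (A' : EY →L[ℝ] EY) := by
    rw [Function.comp_apply, hleft]; exact hA'
  have h2 := hA''.comp _ h1
  have h3 : HasMFDerivAt 𝓘(ℝ, EX) 𝓘(ℝ, EY) (e'.extend J ∘ g ∘ (e.extend I).symm)
      (e.extend I x) l :=
    l.hasMFDerivAt.congr_of_eventuallyEq (heq.eventuallyEq_of_mem hT)
  exact congrArg (fun k : EX →L[ℝ] EY => k v) (hasMFDerivAt_unique h2 h3)

end Charts

/-! ### The image of `𝓕` as a local zero set -/

section Submanifolds

variable {EX HX X EY HY Y : Type*}
  [NormedAddCommGroup EX] [NormedSpace ℝ EX] [TopologicalSpace HX]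
  {I : ModelWithCorners ℝ EX HX} [TopologicalSpace X] [ChartedSpace HX X]
  [NormedAddCommGroup EY] [NormedSpace ℝ EY] [TopologicalSpace HY]
  {J : ModelWithCorners ℝ EY HY} [TopologicalSpace Y] [ChartedSpace HY Y]

/-- In the charts supplied by the definition, `g` is the projection of a product, so a preimage is
obtained by taking zero as the complementary component. -/
theorem mfderiv_surjective_of_isSubmersionAt [I.Boundaryless] [J.Boundaryless] {g : X → Y} {x : X}
    (hg : Manifold.IsSubmersionAt I J ∞ g x) {g' : EX →L[ℝ] EY} (hg' : HasMFDerivAt I J g x g') :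
    Function.Surjective g' := by
  obtain ⟨A, -, hA⟩ := exists_hasMFDerivAt_extend hg.domChart_mem_maximalAtlas
    hg.mem_domChart_source
  obtain ⟨A', hA', -⟩ := exists_hasMFDerivAt_extend hg.codChart_mem_maximalAtlas
    hg.mem_codChart_source
  have h := comp_mfderiv_eq_of_eqOn hg' hg.mem_domChart_source hA hA'
    (l := (ContinuousLinearMap.fst ℝ EY hg.complement).comp
      (hg.equiv : EX →L[ℝ] EY × hg.complement)) hg.writtenInCharts
  intro w
  refine ⟨A.symm (hg.equiv.symm (A' w, 0)), A'.injective ?_⟩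
  rw [h]
  simp

/-- Near a point of the image, the image of a submersion onto a closed submanifold is the zero set
of a submersion `ψ` to a vector space, and the kernel of the derivative of `ψ` is tangent to the
image. -/
theorem IsSubmersionOntoClosedSubmanifold.exists_defining_submersion [I.Boundaryless]
    [J.Boundaryless] [FiniteDimensional ℝ EY]
    {g : X → Y} (hg : IsSubmersionOntoClosedSubmanifold I J g) (a : X) {g' : EX →L[ℝ] EY}
    (hg' : HasMFDerivAt I J g a g') :
    ∃ (k : ℕ) (ψ : Y → Fin k → ℝ) (W : Set Y), IsOpen W ∧ g a ∈ W ∧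
      ContMDiffOn J 𝓘(ℝ, Fin k → ℝ) ∞ ψ W ∧
      (∀ q ∈ W, ∃ l : EY →L[ℝ] (Fin k → ℝ),
        HasMFDerivAt J 𝓘(ℝ, Fin k → ℝ) ψ q l ∧ Function.Surjective l) ∧
      Set.range g ∩ W = {q ∈ W | ψ q = 0} ∧
      ∃ l : EY →L[ℝ] (Fin k → ℝ), HasMFDerivAt J 𝓘(ℝ, Fin k → ℝ) ψ (g a) l ∧
        ∀ w, l w = 0 → ∃ v, g' v = w := by
  obtain ⟨-, d, cs, hM, hemb, hsub⟩ := hg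
  let s₀ : Set.range g := Set.rangeFactorization g a
  have him : Manifold.IsImmersionAt (𝓡 d) J ∞ (Subtype.val : Set.range g → Y) s₀ :=
    hemb.isImmersion.isImmersionAt s₀
  -- In the immersion charts the inclusion is `u ↦ e (u, 0)`. The defining map `ψ` will be the
  -- `C`-component of the chart of `Y`, in a basis of `C`.
  let C := him.complement
  let cod := him.codChart
  let dom := him.domChart
  let e : (EuclideanSpace ℝ (Fin d) × C) ≃L[ℝ] EY := him.equiv
  have hcod : cod ∈ IsManifold.maximalAtlas J ∞ Y := him.codChart_mem_maximalAtlas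
  have hloc : Set.EqOn (cod.extend J ∘ Subtype.val ∘ (dom.extend (𝓡 d)).symm) (e ∘ (·, 0))
      (dom.extend (𝓡 d)).target := him.writtenInCharts
  have : FiniteDimensional ℝ (EuclideanSpace ℝ (Fin d) × C) :=
    e.symm.toLinearEquiv.finiteDimensional
  have : FiniteDimensional ℝ C :=
    FiniteDimensional.of_surjective (LinearMap.snd ℝ (EuclideanSpace ℝ (Fin d)) C)
      LinearMap.snd_surjective
  let k := Module.finrank ℝ C
  let b : C ≃L[ℝ] (Fin k → ℝ) := (Module.finBasis ℝ C).equivFun.toContinuousLinearEquiv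
  let m : EY →L[ℝ] (Fin k → ℝ) :=
    (b : C →L[ℝ] (Fin k → ℝ)) ∘L (ContinuousLinearMap.snd ℝ (EuclideanSpace ℝ (Fin d)) C) ∘L
      (e.symm : EY →L[ℝ] EuclideanSpace ℝ (Fin d) × C)
  have hm : ∀ y, m y = 0 ↔ (e.symm y).2 = 0 := fun y => by simp [m]
  have hm_surj : Function.Surjective m := fun z => ⟨e (0, b.symm z), by simp [m]⟩
  let D := (dom.extend (𝓡 d)).target
  have hD : IsOpen D := dom.isOpen_extend_target
  -- The normal form describes only the piece `dom.source` of the image. As the inclusion is a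
  -- topological embedding, this piece is the trace of an open set `O`, and intersecting with `O`
  -- removes any other part of the image from `W`. The condition on `D` ensures in turn that every
  -- zero of `ψ` in `W` is a point of that piece.
  obtain ⟨O, hO, hO'⟩ := hemb.isEmbedding.isOpen_iff.1 dom.open_source
  let W : Set Y := (cod.source ∩ (fun q => (e.symm (cod.extend J q)).1) ⁻¹' D) ∩ O
  have hs₀ : s₀ ∈ dom.source := him.mem_domChart_source
  have hga : g a ∈ cod.source := him.mem_codChart_source
  have key : ∀ s ∈ dom.source, cod.extend J (s : Y) = e (dom.extend (𝓡 d) s, 0) ∧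
      dom.extend (𝓡 d) s ∈ D := by
    intro s hs
    have hs' : s ∈ (dom.extend (𝓡 d)).source := by rwa [dom.extend_source]
    have h1 := hloc ((dom.extend (𝓡 d)).map_source hs')
    simp only [Function.comp_apply] at h1
    rw [(dom.extend (𝓡 d)).left_inv hs'] at h1
    exact ⟨h1, (dom.extend (𝓡 d)).map_source hs'⟩
  have hWo : IsOpen W := by
    refine IsOpen.inter ?_ hO
    refine ContinuousOn.isOpen_inter_preimage ?_ cod.open_source hD
    exact (continuous_fst.comp e.symm.continuous).comp_continuousOn
      (cod.contMDiffOn_extend hcod).continuousOn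
  have hsubW : ∀ s : Set.range g, s ∈ dom.source → (s : Y) ∈ W := by
    intro s hs
    refine ⟨⟨him.source_subset_preimage_source hs, ?_⟩, ?_⟩
    · change (e.symm (cod.extend J (s : Y))).1 ∈ D
      rw [(key s hs).1]
      simpa using (key s hs).2
    · rw [← hO'] at hs
      exact hs
  have hψd : ∀ q ∈ cod.source, ∃ A : EY ≃L[ℝ] EY,
      HasMFDerivAt J 𝓘(ℝ, EY) (cod.extend J) q (A : EY →L[ℝ] EY) ∧
      HasMFDerivAt J 𝓘(ℝ, Fin k → ℝ) (fun q => m (cod.extend J q)) q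
        (m ∘L (A : EY →L[ℝ] EY)) := by
    intro q hq
    obtain ⟨A, hA, -⟩ := exists_hasMFDerivAt_extend hcod hq
    exact ⟨A, hA, m.hasMFDerivAt.comp q hA⟩
  refine ⟨k, fun q => m (cod.extend J q), W, hWo, hsubW s₀ hs₀, ?_, ?_, ?_, ?_⟩
  · exact m.contMDiff.comp_contMDiffOn
      ((cod.contMDiffOn_extend hcod).mono fun q hq => hq.1.1)
  · intro q hq
    obtain ⟨A, -, hA⟩ := hψd q hq.1.1
    exact ⟨_, hA, hm_surj.comp A.surjective⟩
  · ext q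
    constructor
    · rintro ⟨hq, hqW⟩
      refine ⟨hqW, ?_⟩
      have hs : (⟨q, hq⟩ : Set.range g) ∈ dom.source := by
        rw [← hO']
        exact hqW.2
      have h1 := (key _ hs).1
      simp only at h1
      rw [hm, h1]
      simp
    · rintro ⟨hqW, hq0⟩
      refine ⟨?_, hqW⟩
      rw [hm] at hq0
      let s := (dom.extend (𝓡 d)).symm (e.symm (cod.extend J q)).1
      have hu : (e.symm (cod.extend J q)).1 ∈ D := hqW.1.2
      have hs : s ∈ dom.source := by
        have := (dom.extend (𝓡 d)).map_target hu
        rwa [dom.extend_source] at this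
      have h1 : cod.extend J (s : Y) = cod.extend J q := by
        have h2 := hloc hu
        simp only [Function.comp_apply] at h2
        rw [h2, ← hq0, Prod.mk.eta, e.apply_symm_apply]
      have h3 : (s : Y) = q := by
        refine (cod.extend J).injOn ?_ ?_ h1
        · rw [cod.extend_source]; exact him.source_subset_preimage_source hs
        · rw [cod.extend_source]; exact hqW.1.1
      rw [← h3]
      exact s.2
  · obtain ⟨A', hA', hA''⟩ := hψd (g a) hga
    refine ⟨_, hA'', fun w hw => ?_⟩
    obtain ⟨A, -, hA⟩ := exists_hasMFDerivAt_extend him.domChart_mem_maximalAtlas hs₀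
    have hι : MDifferentiableAt (𝓡 d) J (Subtype.val : Set.range g → Y) s₀ :=
      him.contMDiffAt.mdifferentiableAt (by simp)
    let ι' : EuclideanSpace ℝ (Fin d) →L[ℝ] EY := mfderiv (𝓡 d) J Subtype.val s₀
    have hι' : HasMFDerivAt (𝓡 d) J (Subtype.val : Set.range g → Y) s₀ ι' := hι.hasMFDerivAt
    -- In the charts the derivative of the inclusion is `u ↦ e (u, 0)`, whose range is the kernel of
    -- the derivative of `ψ`.
    have hc := comp_mfderiv_eq_of_eqOn hι' hs₀ hA hA'
      (l := (e : (EuclideanSpace ℝ (Fin d) × C) →L[ℝ] EY) ∘L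
        ContinuousLinearMap.inl ℝ (EuclideanSpace ℝ (Fin d)) C) hloc
    have hsa := hsub.isSubmersionAt a
    let r' : EX →L[ℝ] EuclideanSpace ℝ (Fin d) := mfderiv I (𝓡 d) (Set.rangeFactorization g) a
    have hr' : HasMFDerivAt I (𝓡 d) (Set.rangeFactorization g) a r' :=
      (hsa.contMDiffAt.mdifferentiableAt (by simp)).hasMFDerivAt
    -- The derivative of `g` factors through the tangent space of the image, onto which `r'` is
    -- surjective because `g` is a submersion onto its image.
    have hcomp : g' = ι' ∘L r' := hasMFDerivAt_unique hg'
      (HasMFDerivAt.comp (f := Set.rangeFactorization g) (g := Subtype.val) a hι' hr')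
    have hw' : (e.symm (A' w)).2 = 0 := (hm _).1 hw
    obtain ⟨v, hv⟩ := mfderiv_surjective_of_isSubmersionAt hsa hr' (A.symm (e.symm (A' w)).1)
    refine ⟨v, A'.injective ?_⟩
    rw [hcomp, ContinuousLinearMap.comp_apply, hv, hc]
    change e ((e.symm (A' w)).1, 0) = A' w
    rw [← hw', Prod.mk.eta, e.apply_symm_apply]

end Submanifolds

/-! ### Independent defining functions -/

section DefiningFunctions

/-- The components of a linear map to `ℝᵏ` are independent if and only if the map is surjective. -/
theorem linearIndependent_proj_comp_iff {k : ℕ} {V : Type*} [AddCommGroup V] [Module ℝ V]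
    [TopologicalSpace V] [IsTopologicalAddGroup V] [ContinuousSMul ℝ V]
    (l : V →L[ℝ] (Fin k → ℝ)) :
    (LinearIndependent ℝ fun μ => (ContinuousLinearMap.proj μ : (Fin k → ℝ) →L[ℝ] ℝ) ∘L l) ↔
      Function.Surjective l := by
  rw [Fintype.linearIndependent_iff]
  constructor
  · intro h
    -- A nonzero linear form that vanishes on a proper range has coefficients which are a nontrivial
    -- relation between the components.
    by_contra hs
    have hlt : LinearMap.range l.toLinearMap < ⊤ :=
      lt_top_iff_ne_top.2 fun hr => hs (LinearMap.range_eq_top.1 hr)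
    obtain ⟨f, hf0, hf⟩ := Submodule.exists_le_ker_of_lt_top _ hlt
    have hsum : ∀ x : Fin k → ℝ, f x = ∑ μ, f (Pi.single μ 1) * x μ := by
      intro x
      conv_lhs => rw [pi_eq_sum_univ' x, map_sum]
      refine Finset.sum_congr rfl fun μ _ => ?_
      rw [map_smul, smul_eq_mul, mul_comm]
    have h0 := h (fun μ => f (Pi.single μ 1)) <| by
      ext v
      have h1 : f (l v) = 0 := hf ⟨v, rfl⟩
      rw [hsum] at h1
      simpa using h1
    refine hf0 (LinearMap.ext fun x => ?_)
    rw [hsum]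
    simp [h0]
  · intro h c hc μ
    obtain ⟨v, hv⟩ := h (Pi.single μ 1)
    have := DFunLike.congr_fun hc v
    simpa [hv, Pi.single_apply] using this

variable {EX HX X EY HY Y : Type*}
  [NormedAddCommGroup EX] [NormedSpace ℝ EX] [TopologicalSpace HX]
  {I : ModelWithCorners ℝ EX HX} [TopologicalSpace X] [ChartedSpace HX X]
  [NormedAddCommGroup EY] [NormedSpace ℝ EY] [TopologicalSpace HY]
  {J : ModelWithCorners ℝ EY HY} [TopologicalSpace Y] [ChartedSpace HY Y]

theorem mvfderiv_eq_of_hasMFDerivAt {φ : Y → ℝ} {p : Y} {l : EY →L[ℝ] ℝ}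
    (h : HasMFDerivAt J 𝓘(ℝ, ℝ) φ p l) : mvfderiv J φ p = l := by
  ext v
  exact congrArg (fun l : EY →L[ℝ] ℝ => l v) h.mfderiv

/-- This passes between the independence in `DefinesOn` and the surjectivity that the implicit
function theorem requires. -/
theorem linearIndependent_mvfderiv_iff {k : ℕ} {φ : Fin k → Y → ℝ} {p : Y}
    {l : EY →L[ℝ] (Fin k → ℝ)}
    (h : HasMFDerivAt J 𝓘(ℝ, Fin k → ℝ) (fun q μ => φ μ q) p l) :
    (LinearIndependent ℝ fun μ => mvfderiv J (φ μ) p) ↔ Function.Surjective l := by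
  have h1 : (fun μ => mvfderiv J (φ μ) p) =
      fun μ => (ContinuousLinearMap.proj μ : (Fin k → ℝ) →L[ℝ] ℝ) ∘L l := by
    funext μ
    exact mvfderiv_eq_of_hasMFDerivAt
      ((ContinuousLinearMap.proj μ : (Fin k → ℝ) →L[ℝ] ℝ).hasMFDerivAt.comp p h)
  rw [h1]
  exact linearIndependent_proj_comp_iff (V := EY) l

/-- A map which is smooth near a point coincides near this point with a globally smooth map. -/
theorem exists_contMDiff_eventuallyEq [FiniteDimensional ℝ EY] [T2Space Y] [IsManifold J ∞ Y]
    {G : Type*} [NormedAddCommGroup G] [NormedSpace ℝ G] {ψ : Y → G} {W : Set Y} (hW : IsOpen W)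
    (hψ : ContMDiffOn J 𝓘(ℝ, G) ∞ ψ W) {p : Y} (hp : p ∈ W) :
    ∃ ψ' : Y → G, ContMDiff J 𝓘(ℝ, G) ∞ ψ' ∧ ψ' =ᶠ[𝓝 p] ψ := by
  -- The closed support of the bump function `b` lies in `W`, so `b • ψ` is smooth everywhere
  -- although `ψ` is controlled only on `W`.
  obtain ⟨b, -, hb⟩ := (SmoothBumpFunction.nhds_basis_tsupport (I := J) p).mem_iff.1
    (hW.mem_nhds hp)
  refine ⟨fun q => b q • ψ q, contMDiff_of_tsupport fun q hq => ?_, ?_⟩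
  · have hq' : q ∈ W := hb (tsupport_smul_subset_left _ _ hq)
    exact b.contMDiffAt.smul ((hψ q hq').contMDiffAt (hW.mem_nhds hq'))
  · filter_upwards [b.eventuallyEq_one] with q hq
    simp [hq]

/-- The image of a submersion onto a closed submanifold is locally defined by the vanishing of
independent functions. -/
theorem IsSubmersionOntoClosedSubmanifold.exists_definesOn [I.Boundaryless]
    [J.Boundaryless] [FiniteDimensional ℝ EY] [T2Space Y] [IsManifold J ∞ Y]
    {g : X → Y} (hg : IsSubmersionOntoClosedSubmanifold I J g) (hgd : ContMDiff I J ∞ g) (a : X) :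
    ∃ (U : Set Y) (k : ℕ) (φ : Fin k → Y → ℝ), g a ∈ U ∧
      (∀ μ, ContMDiff J 𝓘(ℝ, ℝ) ∞ (φ μ)) ∧
      (∀ q ∈ U, LinearIndependent ℝ fun μ => mvfderiv J (φ μ) q) ∧
      DefinesOn J φ (Set.range g) U := by
  obtain ⟨k, ψ, W, hW, haW, hψ, hψ', hgW, -⟩ :=
    hg.exists_defining_submersion a (hgd.mdifferentiable (by simp) a).hasMFDerivAt
  obtain ⟨ψ', hψ's, heq⟩ := exists_contMDiff_eventuallyEq hW hψ haW
  obtain ⟨O, hO, hOo, haO⟩ := eventually_nhds_iff.1 heq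
  have hs : ∀ μ, ContMDiff J 𝓘(ℝ, ℝ) ∞ fun q => ψ' q μ := contMDiff_pi_space.1 hψ's
  have hli : ∀ q ∈ W ∩ O, LinearIndependent ℝ fun μ => mvfderiv J (fun q => ψ' q μ) q := by
    rintro q ⟨hqW, hqO⟩
    obtain ⟨l, hl, hls⟩ := hψ' q hqW
    exact (linearIndependent_mvfderiv_iff (hl.congr_of_eventuallyEq
      (Filter.eventuallyEq_of_mem (hOo.mem_nhds hqO) hO))).2 hls
  refine ⟨W ∩ O, k, fun μ q => ψ' q μ, ⟨haW, haO⟩, hs, hli, hW.inter hOo,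
    fun μ => (hs μ).contMDiffOn, ?_, fun q hq => hli q hq.2⟩
  rw [← Set.inter_assoc, hgW]
  ext q
  constructor
  · rintro ⟨⟨hqW, hq0⟩, hqO⟩
    exact ⟨⟨hqW, hqO⟩, fun μ => by rw [hO q hqO, hq0]; rfl⟩
  · rintro ⟨⟨hqW, hqO⟩, hq0⟩
    exact ⟨⟨hqW, by rw [← hO q hqO]; exact funext hq0⟩, hqO⟩

/-- The common kernel of the differentials of independent functions defining the image of a
submersion onto a closed submanifold consists of tangent vectors of the image. -/
theorem IsSubmersionOntoClosedSubmanifold.mem_range_of_mvfderiv_eq_zero [I.Boundaryless]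
    [J.Boundaryless] [FiniteDimensional ℝ EY] [IsManifold J ∞ Y]
    {g : X → Y} (hg : IsSubmersionOntoClosedSubmanifold I J g) {a : X} {g' : EX →L[ℝ] EY}
    (hg' : HasMFDerivAt I J g a g') {U : Set Y} {k : ℕ} {φ : Fin k → Y → ℝ}
    (hφ : DefinesOn J φ (Set.range g) U) (ha : g a ∈ U) {w : EY}
    (hw : ∀ μ, mvfderiv J (φ μ) (g a) w = 0) : ∃ v, g' v = w := by
  -- The given functions are compared with a map `ψ` for which the kernel of the derivative is
  -- already known to be tangent to the image. It remains to show that the derivative of `ψ` kills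
  -- `w`; no dimension count is needed.
  obtain ⟨m, ψ, W, hW, haW, -, -, hgW, l, hl, hlker⟩ := hg.exists_defining_submersion a hg'
  refine hlker w ?_
  set p := g a with hp
  let Φ : Y → Fin k → ℝ := fun q μ => φ μ q
  let x := extChartAt J p
  have hΦ : ContMDiffAt J 𝓘(ℝ, Fin k → ℝ) ∞ Φ p :=
    contMDiffAt_pi_space.2 fun μ => (hφ.contMDiffOn μ).contMDiffAt (hφ.isOpen.mem_nhds ha)
  let Φ' : EY →L[ℝ] (Fin k → ℝ) := mfderiv J 𝓘(ℝ, Fin k → ℝ) Φ p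
  have hΦ' : HasMFDerivAt J 𝓘(ℝ, Fin k → ℝ) Φ p Φ' :=
    (hΦ.mdifferentiableAt (by simp)).hasMFDerivAt
  have hsurj : Function.Surjective Φ' :=
    (linearIndependent_mvfderiv_iff hΦ').1 (hφ.linearIndependent p ⟨⟨a, rfl⟩, ha⟩)
  have hΦw : Φ' w = 0 := by
    funext μ
    have := mvfderiv_eq_of_hasMFDerivAt
      ((ContinuousLinearMap.proj μ : (Fin k → ℝ) →L[ℝ] ℝ).hasMFDerivAt.comp p hΦ')
    exact (congrArg (fun l : EY →L[ℝ] ℝ => l w) this).symm.trans (hw μ)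
  obtain ⟨A, hA, hA'⟩ := exists_hasMFDerivAt_extend (J := J)
    (IsManifold.chart_mem_maximalAtlas (I := J) (n := ∞) p) (mem_chart_source HY p)
  have hxp : x.symm (x p) = p := x.left_inv (mem_extChartAt_source p)
  -- the functions read in the chart
  have hcd : ContDiffAt ℝ ∞ (Φ ∘ x.symm) (x p) := by
    have h1 : ContMDiffAt 𝓘(ℝ, EY) J ∞ x.symm (x p) :=
      (contMDiffOn_extChartAt_symm p).contMDiffAt (extChartAt_target_mem_nhds p)
    rw [← hxp] at hΦ
    exact (hΦ.comp (x p) h1).contDiffAt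
  have hmd : HasMFDerivAt 𝓘(ℝ, EY) 𝓘(ℝ, Fin k → ℝ) (Φ ∘ x.symm) (x p)
      (Φ' ∘L (A.symm : EY →L[ℝ] EY)) := by
    rw [← hxp] at hΦ'
    exact hΦ'.comp (x p) hA'
  have hstrict : HasStrictFDerivAt (Φ ∘ x.symm) (Φ' ∘L (A.symm : EY →L[ℝ] EY)) (x p) := by
    have h := hcd.hasStrictFDerivAt (by simp)
    have hfd : HasFDerivAt (Φ ∘ x.symm) (Φ' ∘L (A.symm : EY →L[ℝ] EY)) (x p) := hmd.hasFDerivAt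
    rwa [hfd.fderiv] at h
  -- `w` is the velocity of a curve in the common zero set of the `φ μ`, that is, in the image of
  -- `g`. Since `ψ` vanishes on the image near `p`, it is constant along the curve for small `t`.
  obtain ⟨c, hc0, hcd, hcΦ⟩ := exists_curve_of_mem_ker hstrict (hsurj.comp A.symm.surjective)
    (w := A w) (by simpa using hΦw)
  have hcont : ContinuousAt (x.symm ∘ c) 0 := by
    refine ContinuousAt.comp ?_ hcd.continuousAt
    rw [hc0]
    exact continuousAt_extChartAt_symm p
  have hc0' : (x.symm ∘ c) 0 = p := by rw [Function.comp_apply, hc0, hxp]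
  have hzero : ∀ᶠ t in 𝓝 (0 : ℝ), ψ (x.symm (c t)) = 0 := by
    have hUW := hcont.preimage_mem_nhds (t := U ∩ W)
      (by rw [hc0']; exact (hφ.isOpen.inter hW).mem_nhds ⟨ha, haW⟩)
    filter_upwards [hUW, hcΦ] with t ht hΦt
    have hp0 : p ∈ {q ∈ U | ∀ μ, φ μ q = 0} := hφ.inter_eq ▸ ⟨⟨a, rfl⟩, ha⟩
    have h1 : x.symm (c t) ∈ Set.range g ∩ U := by
      rw [hφ.inter_eq]
      refine ⟨ht.1, fun μ => ?_⟩
      have h2 := congrFun hΦt μ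
      simp only [Function.comp_apply, hxp] at h2
      exact h2.trans (hp0.2 μ)
    have h3 : x.symm (c t) ∈ {q ∈ W | ψ q = 0} := hgW ▸ ⟨h1.1, ht.2⟩
    exact h3.2
  have hd : HasMFDerivAt 𝓘(ℝ, ℝ) 𝓘(ℝ, Fin m → ℝ) (ψ ∘ x.symm ∘ c) 0
      (l ∘L (A.symm : EY →L[ℝ] EY) ∘L ContinuousLinearMap.toSpanSingleton ℝ (A w)) := by
    have h1 : HasMFDerivAt 𝓘(ℝ, EY) 𝓘(ℝ, Fin m → ℝ) (ψ ∘ x.symm) (c 0)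
        (l ∘L (A.symm : EY →L[ℝ] EY)) := by
      rw [hc0]
      rw [← hxp] at hl
      exact hl.comp (x p) hA'
    exact h1.comp (0 : ℝ) hcd.hasFDerivAt.hasMFDerivAt
  have h0 := hasMFDerivAt_unique hd
    ((hasMFDerivAt_const (0 : Fin m → ℝ) (0 : ℝ)).congr_of_eventuallyEq hzero)
  have h1 : l (A.symm ((1 : ℝ) • A w)) = 0 :=
    congrArg (fun k : ℝ →L[ℝ] (Fin m → ℝ) => k 1) h0
  rwa [one_smul, A.symm_apply_apply] at h1

end DefiningFunctions

/-! ### Smoothness of partial derivatives -/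

section PartialDerivative

variable {EB HB M : Type*} [NormedAddCommGroup EB] [NormedSpace ℝ EB] [TopologicalSpace HB]
  {IB : ModelWithCorners ℝ EB HB} [TopologicalSpace M] [ChartedSpace HB M] [IsManifold IB ∞ M]
  {G : Type*} [NormedAddCommGroup G] [NormedSpace ℝ G]
  {G' : Type*} [NormedAddCommGroup G'] [NormedSpace ℝ G']

/-- The partial derivative with respect to a vector variable of a smooth map is smooth. -/
theorem contMDiffAt_fderiv_snd {h : M × G → G'} {z : M × G}
    (hh : ContMDiffAt (IB.prod 𝓘(ℝ, G)) 𝓘(ℝ, G') ∞ h z) :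
    ContMDiffAt (IB.prod 𝓘(ℝ, G)) 𝓘(ℝ, G →L[ℝ] G') ∞
      (fun y : M × G => fderiv ℝ (fun w => h (y.1, w)) y.2) z := by
  -- The whole point `y` serves as the parameter and only `y.1` enters the function; the second
  -- component of `y` reappears as the point where the derivative in `w` is taken.
  have h1 : ContMDiffAt ((IB.prod 𝓘(ℝ, G)).prod 𝓘(ℝ, G)) 𝓘(ℝ, G') ∞
      (Function.uncurry fun (y : M × G) (w : G) => h (y.1, w)) (z, z.2) := by
    have h2 : ContMDiffAt ((IB.prod 𝓘(ℝ, G)).prod 𝓘(ℝ, G)) (IB.prod 𝓘(ℝ, G)) ∞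
        (fun y : (M × G) × G => (y.1.1, y.2)) (z, z.2) :=
      (contMDiffAt_fst.comp _ contMDiffAt_fst).prodMk contMDiffAt_snd
    exact ContMDiffAt.comp (z, z.2) (g := h) hh h2
  have h3 := ContMDiffAt.mfderiv (fun (y : M × G) (w : G) => h (y.1, w)) Prod.snd h1
    contMDiffAt_snd (m := ∞) (by simp)
  simpa only [inTangentCoordinates_model_space, mfderiv_eq_fderiv] using h3

end PartialDerivative

/-! ### Fibre charts of `A` and the dual trivialization -/

section FibreCharts

variable {EB HB M EA HA : Type*} (F : Type*) (E A : M → Type*)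
  [NormedAddCommGroup EB] [NormedSpace ℝ EB] [TopologicalSpace HB]
  (IB : ModelWithCorners ℝ EB HB) [TopologicalSpace M] [ChartedSpace HB M]
  [NormedAddCommGroup F] [NormedSpace ℝ F]
  [∀ x, AddCommGroup (E x)] [∀ x, Module ℝ (E x)] [∀ x, TopologicalSpace (E x)]
  [TopologicalSpace (TotalSpace F E)] [FiberBundle F E] [VectorBundle ℝ F E]
  [NormedAddCommGroup EA] [NormedSpace ℝ EA] [TopologicalSpace HA]
  (IA : ModelWithCorners ℝ EA HA)
  [TopologicalSpace (TotalSpace F A)] [ChartedSpace HA (TotalSpace F A)]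
  [∀ x, AddTorsor (E x) (A x)]

/-- A local trivialization of the affine bundle `A` around `x₀`, given by
`toFun : (x, v) ↦ s x + v` and by the fibre coordinate `coord`, and compatible with the
trivialization of `E` at `x₀`. -/
structure FibreChart (x₀ : M) where
  /-- The domain of the chart in the base. -/
  baseSet : Set M
  /-- The parametrization of `A` over `baseSet`. -/
  toFun : M × F → TotalSpace F A
  /-- The fibre coordinate. -/
  coord : TotalSpace F A → F
  isOpen_baseSet : IsOpen baseSet
  mem_baseSet : x₀ ∈ baseSet
  baseSet_subset : baseSet ⊆ (trivializationAt F E x₀).baseSet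
  contMDiffOn_toFun : ContMDiffOn (IB.prod 𝓘(ℝ, F)) IA ∞ toFun (baseSet ×ˢ Set.univ)
  contMDiffOn_coord : ContMDiffOn IA 𝓘(ℝ, F) ∞ coord (π F A ⁻¹' baseSet)
  toFun_fst : ∀ x ∈ baseSet, ∀ v, (toFun (x, v)).1 = x
  coord_toFun : ∀ x ∈ baseSet, ∀ v, coord (toFun (x, v)) = v
  toFun_coord : ∀ b : TotalSpace F A, b.1 ∈ baseSet → toFun (b.1, coord b) = b
  coord_vadd : ∀ b : TotalSpace F A, b.1 ∈ baseSet → ∀ w : E b.1,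
    coord ⟨b.1, w +ᵥ b.2⟩ = coord b + (trivializationAt F E x₀ ⟨b.1, w⟩).2

/-- A local section identifies `A` with `E`, and a trivialization identifies `E` with a product.
Fibrewise linearity of the trivialization gives the compatibility `coord_vadd`. -/
theorem nonempty_fibreChart [ContMDiffVectorBundle ∞ F E IB] [SmoothAffineBundle F E A IB IA]
    (x₀ : M) : Nonempty (FibreChart F E A IB IA x₀) := by
  obtain ⟨U, hU, hxU, s, hΨ, hΘ⟩ :=
    SmoothAffineBundle.exists_section (F := F) (E := E) (A := A) (IB := IB) (IA := IA) x₀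
  set e := trivializationAt F E x₀ with he
  let Ψ : TotalSpace F E → TotalSpace F A := fun v => ⟨v.1, v.2 +ᵥ s v.1⟩
  let Θ : TotalSpace F A → TotalSpace F E := fun b => ⟨b.1, b.2 -ᵥ s b.1⟩
  have hΘΨ : ∀ z, Θ (Ψ z) = z := fun z => by simp [Θ, Ψ]
  have hΨΘ : ∀ z, Ψ (Θ z) = z := fun z => by simp [Θ, Ψ]
  have hfst : ∀ x ∈ U ∩ e.baseSet, ∀ v, (e.toOpenPartialHomeomorph.symm (x, v)).1 = x :=
    fun x hx v => e.proj_symm_apply (e.mem_target.2 hx.2)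
  refine ⟨{
    baseSet := U ∩ e.baseSet
    toFun := fun z => Ψ (e.toOpenPartialHomeomorph.symm z)
    coord := fun b => (e (Θ b)).2
    isOpen_baseSet := hU.inter e.open_baseSet
    mem_baseSet := ⟨hxU, mem_baseSet_trivializationAt F E x₀⟩
    baseSet_subset := Set.inter_subset_right
    contMDiffOn_toFun := ?_
    contMDiffOn_coord := ?_
    toFun_fst := hfst
    coord_toFun := ?_
    toFun_coord := ?_
    coord_vadd := ?_ }⟩
  · refine hΨ.comp ((e.contMDiffOn_symm (IB := IB) (n := ∞)).mono ?_) ?_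
    · rintro ⟨x, v⟩ ⟨hx, -⟩
      exact e.mem_target.2 hx.2
    · rintro ⟨x, v⟩ ⟨hx, -⟩
      change (e.toOpenPartialHomeomorph.symm (x, v)).1 ∈ U
      rw [hfst x hx]
      exact hx.1
  · have h1 : ContMDiffOn IA (IB.prod 𝓘(ℝ, F)) ∞ (fun b => e (Θ b)) (π F A ⁻¹' (U ∩ e.baseSet)) :=
      (e.contMDiffOn (IB := IB) (n := ∞)).comp (hΘ.mono fun b hb => hb.1)
        fun b hb => e.mem_source.2 hb.2
    exact contMDiff_snd.comp_contMDiffOn h1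
  · intro x hx v
    rw [hΘΨ]
    exact congrArg Prod.snd (e.toOpenPartialHomeomorph.right_inv (e.mem_target.2 hx.2))
  · intro b hb
    have h2 : Θ b ∈ e.source := e.mem_source.2 hb.2
    have h1 : e (Θ b) = (b.1, (e (Θ b)).2) := Prod.ext (e.coe_fst h2) rfl
    have h3 : e.toOpenPartialHomeomorph.symm (e (Θ b)) = Θ b :=
      e.toOpenPartialHomeomorph.left_inv h2
    rw [← h1, h3, hΨΘ]
  · intro b hb w
    have h := e.linear ℝ hb.2
    have h1 : Θ ⟨b.1, w +ᵥ b.2⟩ = ⟨b.1, (b.2 -ᵥ s b.1) + w⟩ := by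
      simp [Θ, vadd_vsub_assoc, add_comm]
    rw [h1]
    exact h.map_add _ _

variable {F E A} {IB IA}

namespace FibreChart

variable {x₀ : M} (c : FibreChart F E A IB IA x₀)

/-- The linear part of the chart in the fibre of `E` over `x`. -/
def linear {x : M} (hx : x ∈ c.baseSet) : E x ≃L[ℝ] F :=
  (trivializationAt F E x₀).continuousLinearEquivAt ℝ x (c.baseSet_subset hx)

/-- The induced coordinate in the fibre of `E^*` over `x`. -/
def dual {x : M} (hx : x ∈ c.baseSet) : (E x →L[ℝ] ℝ) ≃L[ℝ] (F →L[ℝ] ℝ) :=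
  (c.linear hx).arrowCongr (ContinuousLinearEquiv.refl ℝ ℝ)

theorem dual_apply {x : M} (hx : x ∈ c.baseSet) (α : E x →L[ℝ] ℝ) (v : F) :
    c.dual hx α v = α ((c.linear hx).symm v) := rfl

theorem toFun_coord_add {b : TotalSpace F A} (hb : b.1 ∈ c.baseSet) (w : E b.1) :
    c.toFun (b.1, c.coord b + c.linear hb w) = ⟨b.1, w +ᵥ b.2⟩ := by
  have h := c.coord_vadd b hb w
  rw [← c.toFun_coord ⟨b.1, w +ᵥ b.2⟩ hb, h]
  rfl

theorem contMDiffAt_toFun {x : M} (hx : x ∈ c.baseSet) (v : F) :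
    ContMDiffAt (IB.prod 𝓘(ℝ, F)) IA ∞ c.toFun (x, v) :=
  c.contMDiffOn_toFun.contMDiffAt
    ((c.isOpen_baseSet.prod isOpen_univ).mem_nhds ⟨hx, trivial⟩)

theorem contMDiffAt_coord [SmoothAffineBundle F E A IB IA] {b : TotalSpace F A}
    (hb : b.1 ∈ c.baseSet) : ContMDiffAt IA 𝓘(ℝ, F) ∞ c.coord b :=
  c.contMDiffOn_coord.contMDiffAt ((c.isOpen_baseSet.preimage
    (SmoothAffineBundle.contMDiff_proj (F := F) (E := E) (A := A) (IB := IB)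
      (IA := IA)).continuous).mem_nhds hb)

/-- The fibre derivative of `f` read in the chart. -/
def partialDeriv (f : TotalSpace F A → ℝ) (z : M × F) : F →L[ℝ] ℝ :=
  fderiv ℝ (fun v => f (c.toFun (z.1, v))) z.2

/-- The trivialization of the dual bundle compatible with the chart. -/
def dualTrivialization (_ : FibreChart F E A IB IA x₀) :
    Trivialization (F →L[ℝ] ℝ) (π (F →L[ℝ] ℝ) fun x : M => E x →L[ℝ] Trivial M ℝ x) :=
  trivializationAt (F →L[ℝ] ℝ) (fun x : M => E x →L[ℝ] Trivial M ℝ x) x₀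

instance : MemTrivializationAtlas c.dualTrivialization := by
  unfold dualTrivialization; infer_instance

theorem mem_dualTrivialization_baseSet {x : M} (hx : x ∈ c.baseSet) :
    x ∈ c.dualTrivialization.baseSet :=
  ⟨c.baseSet_subset hx, trivial⟩

/-- The trivialization of a bundle of homomorphisms conjugates by those of the two factors; the
second factor is trivial, so only precomposition with the inverse of `c.linear` remains. -/
theorem dualTrivialization_apply {x : M} (hx : x ∈ c.baseSet) (α : E x →L[ℝ] ℝ) :
    c.dualTrivialization (⟨x, α⟩ : DualSpace F E) = (x, c.dual hx α) := by
  have h := hom_trivializationAt_apply (RingHom.id ℝ) x₀ (⟨x, α⟩ : DualSpace F E)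
  refine h.trans (Prod.ext rfl ?_)
  ext v
  have h2 := congrFun (congrArg DFunLike.coe
    (ContinuousLinearMap.inCoordinates_eq (σ := RingHom.id ℝ) (F := F) (E := E) (F' := ℝ)
    (E' := Trivial M ℝ) (x₀ := x₀) (x := x) (y₀ := x₀) (y := x) (ϕ := α)
    (c.baseSet_subset hx) trivial)) v
  exact h2

theorem dualTrivialization_symm {x : M} (hx : x ∈ c.baseSet) (β : F →L[ℝ] ℝ) :
    c.dualTrivialization.toOpenPartialHomeomorph.symm (x, β) =
      (⟨x, (c.dual hx).symm β⟩ : DualSpace F E) := by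
  have h := c.dualTrivialization_apply hx ((c.dual hx).symm β)
  rw [ContinuousLinearEquiv.apply_symm_apply] at h
  rw [← h]
  exact c.dualTrivialization.toOpenPartialHomeomorph.left_inv
    (c.dualTrivialization.mem_source.2 (c.mem_dualTrivialization_baseSet hx))

end FibreChart

end FibreCharts

/-! ### Formulas for `𝓕`, the hessian and `γ_h` in a fibre chart -/

section LocalFormulas

variable {EB HB M EA HA F : Type*} {E A : M → Type*}
  [NormedAddCommGroup EB] [NormedSpace ℝ EB] [TopologicalSpace HB]
  {IB : ModelWithCorners ℝ EB HB} [TopologicalSpace M] [ChartedSpace HB M]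
  [NormedAddCommGroup F] [NormedSpace ℝ F]
  [∀ x, AddCommGroup (E x)] [∀ x, Module ℝ (E x)] [∀ x, TopologicalSpace (E x)]
  [TopologicalSpace (TotalSpace F E)] [FiberBundle F E] [VectorBundle ℝ F E]
  [NormedAddCommGroup EA] [NormedSpace ℝ EA] [TopologicalSpace HA]
  {IA : ModelWithCorners ℝ EA HA}
  [∀ x, AddTorsor (E x) (A x)]
  {f : TotalSpace F A → ℝ}

/-- The derivative at `a` of the restriction of `f` to the fibre of `a`. -/
def fibreDerivAt (f : TotalSpace F A → ℝ) (a : TotalSpace F A) : E a.1 →L[ℝ] ℝ :=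
  affineDeriv (fun b : A a.1 => f ⟨a.1, b⟩) a.2

variable (F) in
/-- The canonical isomorphism of `F` with its topological bidual. -/
def evalCLE [FiniteDimensional ℝ F] : F ≃L[ℝ] ((F →L[ℝ] ℝ) →L[ℝ] ℝ) :=
  ((Module.evalEquiv ℝ F).trans
    ((LinearMap.toContinuousLinearMap (𝕜 := ℝ) (E := F) (F' := ℝ)).symm.dualMap.trans
      LinearMap.toContinuousLinearMap)).toContinuousLinearEquiv

theorem evalCLE_apply [FiniteDimensional ℝ F] (v : F) (β : F →L[ℝ] ℝ) :
    evalCLE F v β = β v := rfl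

theorem apply_gammaMap [FiniteDimensional ℝ F] (f : TotalSpace F A → ℝ) (h : DualSpace F E → ℝ)
    (a : TotalSpace F A) (α : E a.1 →L[ℝ] ℝ) :
    α (gammaMap f h a) =
      affineDeriv (fun α : E a.1 →L[ℝ] ℝ => h ⟨a.1, α⟩) (fibreDerivAt f a) α := by
  rw [← bidualEquiv_apply (F := F), gammaMap, LinearEquiv.apply_symm_apply]
  rfl

variable [TopologicalSpace (TotalSpace F A)] [ChartedSpace HA (TotalSpace F A)]

namespace FibreChart

variable {x₀ : M} (c : FibreChart F E A IB IA x₀)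

theorem contMDiffAt_comp_toFun (hf : ContMDiff IA 𝓘(ℝ, ℝ) ∞ f) {x : M} (hx : x ∈ c.baseSet)
    (v : F) : ContMDiffAt (IB.prod 𝓘(ℝ, F)) 𝓘(ℝ, ℝ) ∞ (fun z => f (c.toFun z)) (x, v) :=
  hf.contMDiffAt.comp (x, v) (c.contMDiffAt_toFun hx v)

theorem contDiffAt_comp_toFun (hf : ContMDiff IA 𝓘(ℝ, ℝ) ∞ f) {x : M} (hx : x ∈ c.baseSet)
    (v : F) : ContDiffAt ℝ ∞ (fun v => f (c.toFun (x, v))) v :=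
  (ContMDiffAt.comp v (c.contMDiffAt_comp_toFun hf hx v)
    (contMDiffAt_const.prodMk contMDiffAt_id)).contDiffAt

theorem contMDiffAt_dualTrivialization_symm [ContMDiffVectorBundle ∞ F E IB] {x : M}
    (hx : x ∈ c.baseSet) (β : F →L[ℝ] ℝ) :
    ContMDiffAt (IB.prod 𝓘(ℝ, F →L[ℝ] ℝ)) (IB.prod 𝓘(ℝ, F →L[ℝ] ℝ)) ∞
      c.dualTrivialization.toOpenPartialHomeomorph.symm (x, β) :=
  (c.dualTrivialization.contMDiffOn_symm (IB := IB) (n := ∞)).contMDiffAt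
    (c.dualTrivialization.open_target.mem_nhds
      (c.dualTrivialization.mem_target.2 (c.mem_dualTrivialization_baseSet hx)))

/-- The chart is affine on each fibre with linear part `c.linear` (`toFun_coord_add`), so the
derivative along the fibre is the partial derivative up to this linear part. -/
theorem dual_fibreDerivAt (hf : ContMDiff IA 𝓘(ℝ, ℝ) ∞ f) {b : TotalSpace F A}
    (hb : b.1 ∈ c.baseSet) :
    c.dual hb (fibreDerivAt f b) = c.partialDeriv f (b.1, c.coord b) := by
  ext v
  rw [dual_apply]
  have hd : HasFDerivAt (fun v => f (c.toFun (b.1, v))) (c.partialDeriv f (b.1, c.coord b))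
      (c.coord b) :=
    ((c.contDiffAt_comp_toFun hf hb (c.coord b)).differentiableAt (by simp)).hasFDerivAt
  have h := affineDeriv_transport (V := E b.1) (c.linear hb) (ContinuousLinearEquiv.refl ℝ ℝ)
    (g := fun y : A b.1 => f ⟨b.1, y⟩) (p := b.2) (c := f ⟨b.1, b.2⟩)
    (fun w => by rw [c.toFun_coord_add hb w]; rfl) hd ((c.linear hb).symm v)
  rw [ContinuousLinearEquiv.apply_symm_apply] at h
  exact h

theorem dualTrivialization_fibreDeriv (hf : ContMDiff IA 𝓘(ℝ, ℝ) ∞ f) {b : TotalSpace F A}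
    (hb : b.1 ∈ c.baseSet) :
    c.dualTrivialization (fibreDeriv (E := E) f b) =
      (b.1, c.partialDeriv f (b.1, c.coord b)) := by
  rw [← c.dual_fibreDerivAt hf hb]
  exact c.dualTrivialization_apply hb _

/-- The second derivative along the fibres is symmetric. -/
theorem fderiv_partialDeriv_symm (hf : ContMDiff IA 𝓘(ℝ, ℝ) ∞ f) {x : M}
    (hx : x ∈ c.baseSet) (v w w' : F) :
    fderiv ℝ (fun v => c.partialDeriv f (x, v)) v w w' =
      fderiv ℝ (fun v => c.partialDeriv f (x, v)) v w' w :=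
  -- `partialDeriv` is itself a derivative in `v`, so this is the symmetry of a second derivative on
  -- a single fibre.
  ((c.contDiffAt_comp_toFun hf hx v).isSymmSndFDerivAt
    (by rw [minSmoothness_of_isRCLikeNormedField]; exact WithTop.coe_le_coe.2 le_top)) w w'

/-- A function on the dual bundle read in the trivialization. -/
def dualRead (h : DualSpace F E → ℝ) (z : M × (F →L[ℝ] ℝ)) : ℝ :=
  h (c.dualTrivialization.toOpenPartialHomeomorph.symm z)

theorem contMDiffAt_dualRead [ContMDiffVectorBundle ∞ F E IB] {h : DualSpace F E → ℝ} {x : M}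
    (hx : x ∈ c.baseSet) {α : E x →L[ℝ] ℝ}
    (hh : ContMDiffAt (IB.prod 𝓘(ℝ, F →L[ℝ] ℝ)) 𝓘(ℝ, ℝ) ∞ h (⟨x, α⟩ : DualSpace F E)) :
    ContMDiffAt (IB.prod 𝓘(ℝ, F →L[ℝ] ℝ)) 𝓘(ℝ, ℝ) ∞ (c.dualRead h) (x, c.dual hx α) := by
  have h1 := c.dualTrivialization_symm hx (c.dual hx α)
  rw [ContinuousLinearEquiv.symm_apply_apply] at h1
  rw [← h1] at hh
  exact hh.comp _ (c.contMDiffAt_dualTrivialization_symm hx _)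

/-- The trivialization is linear on the fibres of `E^*`, so the fibre derivative of `h` becomes a
partial derivative. This formula yields both the smoothness of `γ_h` and the value of the
differential of `h` on vertical vectors. -/
theorem evalCLE_linear_gammaMap [FiniteDimensional ℝ F] [ContMDiffVectorBundle ∞ F E IB]
    (hf : ContMDiff IA 𝓘(ℝ, ℝ) ∞ f) {b : TotalSpace F A} (hb : b.1 ∈ c.baseSet)
    {h : DualSpace F E → ℝ}
    (hh : ContMDiffAt (IB.prod 𝓘(ℝ, F →L[ℝ] ℝ)) 𝓘(ℝ, ℝ) ∞ h (fibreDeriv (E := E) f b)) :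
    evalCLE F (c.linear hb (gammaMap f h b)) =
      fderiv ℝ (fun β => c.dualRead h (b.1, β)) (c.partialDeriv f (b.1, c.coord b)) := by
  have hs := c.contMDiffAt_dualRead hb (α := fibreDerivAt f b) hh
  rw [c.dual_fibreDerivAt hf hb] at hs
  have hd := ((ContMDiffAt.comp (c.partialDeriv f (b.1, c.coord b)) hs
      (contMDiffAt_const.prodMk contMDiffAt_id)).contDiffAt.differentiableAt
        (by simp)).hasFDerivAt
  ext β
  rw [evalCLE_apply]
  have h1 := apply_gammaMap f h b ((c.dual hb).symm β)
  have h2 := affineDeriv_transport (V := E b.1 →L[ℝ] ℝ) (c.dual hb)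
    (ContinuousLinearEquiv.refl ℝ ℝ) (g := fun α : E b.1 →L[ℝ] ℝ => h ⟨b.1, α⟩)
    (p := (fibreDerivAt f b)) (c := h (fibreDeriv (E := E) f b))
    (fun α => by
      rw [← c.dual_fibreDerivAt hf hb, ← map_add]
      simp only [Function.comp_apply, dualRead, c.dualTrivialization_symm hb]
      rw [ContinuousLinearEquiv.symm_apply_apply, add_comm]
      rfl) hd ((c.dual hb).symm β)
  rw [ContinuousLinearEquiv.apply_symm_apply] at h2
  refine Eq.trans ?_ (h1.trans h2)
  rfl

variable [IsManifold IB ∞ M]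

theorem contMDiffAt_partialDeriv (hf : ContMDiff IA 𝓘(ℝ, ℝ) ∞ f) {x : M} (hx : x ∈ c.baseSet)
    (v : F) : ContMDiffAt (IB.prod 𝓘(ℝ, F)) 𝓘(ℝ, F →L[ℝ] ℝ) ∞ (c.partialDeriv f) (x, v) :=
  contMDiffAt_fderiv_snd (c.contMDiffAt_comp_toFun hf hx v)

/-- Along a fibre, `dual_fibreDerivAt` conjugates the fibre derivative to `partialDeriv`, through
`c.linear` on the source and `c.dual` on the target; differentiating once more gives the hessian. -/
theorem fibreHessian_apply (hf : ContMDiff IA 𝓘(ℝ, ℝ) ∞ f) {b : TotalSpace F A}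
    (hb : b.1 ∈ c.baseSet) (w w' : E b.1) :
    fibreHessian f b w w' =
      fderiv ℝ (fun v => c.partialDeriv f (b.1, v)) (c.coord b) (c.linear hb w)
        (c.linear hb w') := by
  have hd : HasFDerivAt (fun v => c.partialDeriv f (b.1, v))
      (fderiv ℝ (fun v => c.partialDeriv f (b.1, v)) (c.coord b)) (c.coord b) :=
    ((ContMDiffAt.comp (c.coord b) (c.contMDiffAt_partialDeriv hf hb (c.coord b))
      (contMDiffAt_const.prodMk contMDiffAt_id)).contDiffAt.differentiableAt
        (by simp)).hasFDerivAt
  let g : A b.1 → (E b.1 →L[ℝ] ℝ) := fun y => fibreDerivAt f ⟨b.1, y⟩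
  have hg : ∀ u : E b.1, c.dual hb (g (u +ᵥ b.2) -ᵥ g b.2) =
      c.partialDeriv f (b.1, c.coord b + c.linear hb u) - c.dual hb (g b.2) := by
    intro u
    have h1 : c.dual hb (g (u +ᵥ b.2)) = c.partialDeriv f (b.1, c.coord ⟨b.1, u +ᵥ b.2⟩) :=
      c.dual_fibreDerivAt hf (b := ⟨b.1, u +ᵥ b.2⟩) hb
    rw [c.coord_vadd b hb u] at h1
    rw [vsub_eq_sub, map_sub, h1]
    rfl
  have h := affineDeriv_transport (V := E b.1) (W := E b.1 →L[ℝ] ℝ) (c.linear hb) (c.dual hb) hg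
    hd w
  rw [← h, dual_apply, ContinuousLinearEquiv.symm_apply_apply]
  rfl

/-- In the trivialization of `E^*` the fibre component of `𝓕` is `partialDeriv`, a smooth function
of the chart coordinates. -/
theorem contMDiffAt_fibreDeriv [ContMDiffVectorBundle ∞ F E IB] [SmoothAffineBundle F E A IB IA]
    (hf : ContMDiff IA 𝓘(ℝ, ℝ) ∞ f) {a : TotalSpace F A} (ha : a.1 ∈ c.baseSet) :
    ContMDiffAt IA (IB.prod 𝓘(ℝ, F →L[ℝ] ℝ)) ∞ (fibreDeriv (E := E) f) a := by
  have hπ : ContMDiff IA IB ∞ (π F A) :=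
    SmoothAffineBundle.contMDiff_proj (F := F) (E := E) (A := A) (IB := IB) (IA := IA)
  rw [c.dualTrivialization.contMDiffAt_iff
    (c.dualTrivialization.mem_source.2 (c.mem_dualTrivialization_baseSet ha))]
  refine ⟨hπ.contMDiffAt, ?_⟩
  have h1 : ContMDiffAt IA 𝓘(ℝ, F →L[ℝ] ℝ) ∞
      (fun b : TotalSpace F A => c.partialDeriv f (b.1, c.coord b)) a :=
    ContMDiffAt.comp a (c.contMDiffAt_partialDeriv hf ha (c.coord a))
      (hπ.contMDiffAt.prodMk (c.contMDiffAt_coord ha))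
  refine h1.congr_of_eventuallyEq ?_
  filter_upwards [(c.isOpen_baseSet.preimage hπ.continuous).mem_nhds ha] with b hb
  exact congrArg Prod.snd (c.dualTrivialization_fibreDeriv hf hb)

end FibreChart

end LocalFormulas

/-! ### The tangent map of `𝓕` in block form -/

section Pointwise

variable {EB HB M EA HA F : Type*} {E A : M → Type*}
  [NormedAddCommGroup EB] [NormedSpace ℝ EB] [TopologicalSpace HB]
  {IB : ModelWithCorners ℝ EB HB} [TopologicalSpace M] [ChartedSpace HB M] [IsManifold IB ∞ M]
  [NormedAddCommGroup F] [NormedSpace ℝ F]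
  [∀ x, AddCommGroup (E x)] [∀ x, Module ℝ (E x)] [∀ x, TopologicalSpace (E x)]
  [TopologicalSpace (TotalSpace F E)] [FiberBundle F E] [VectorBundle ℝ F E]
  [ContMDiffVectorBundle ∞ F E IB]
  [NormedAddCommGroup EA] [NormedSpace ℝ EA] [TopologicalSpace HA]
  {IA : ModelWithCorners ℝ EA HA}
  [TopologicalSpace (TotalSpace F A)] [ChartedSpace HA (TotalSpace F A)]
  [∀ x, AddTorsor (E x) (A x)] [SmoothAffineBundle F E A IB IA]
  {f : TotalSpace F A → ℝ}

/-- The derivative of the fibre derivative, read through linear isomorphisms `T` and `S` adapted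
to the fibrations, is `(u, v) ↦ (u, B u + D v)`, where `D` is the fibre hessian. -/
theorem exists_derivative_of_fibreDeriv [FiniteDimensional ℝ F]
    (hf : ContMDiff IA 𝓘(ℝ, ℝ) ∞ f) (a : TotalSpace F A) :
    ∃ (L : E a.1 ≃L[ℝ] F) (T : (EB × F) ≃L[ℝ] EA)
      (S : (EB × (F →L[ℝ] ℝ)) ≃L[ℝ] (EB × (F →L[ℝ] ℝ)))
      (B : EB →L[ℝ] (F →L[ℝ] ℝ)) (D : F →L[ℝ] (F →L[ℝ] ℝ)) (G : EA →L[ℝ] EB × (F →L[ℝ] ℝ)),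
      HasMFDerivAt IA (IB.prod 𝓘(ℝ, F →L[ℝ] ℝ)) (fibreDeriv (E := E) f) a G ∧
      (∀ u v, S (G (T (u, v))) = (u, B u + D v)) ∧
      (∀ e, lineVelocity IA a e = T (0, L e)) ∧
      (∀ e e', fibreHessian f a e e' = D (L e) (L e')) ∧
      (∀ v v', D v v' = D v' v) ∧
      ∀ (h : DualSpace F E → ℝ) (l : EB × (F →L[ℝ] ℝ) →L[ℝ] ℝ),
        ContMDiffAt (IB.prod 𝓘(ℝ, F →L[ℝ] ℝ)) 𝓘(ℝ, ℝ) ∞ h (fibreDeriv (E := E) f a) →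
        HasMFDerivAt (IB.prod 𝓘(ℝ, F →L[ℝ] ℝ)) 𝓘(ℝ, ℝ) h (fibreDeriv (E := E) f a) l →
        ∀ β, l (S.symm (0, β)) = β (L (gammaMap f h a)) := by
  obtain ⟨c⟩ := nonempty_fibreChart F E A IB IA a.1
  have ha : a.1 ∈ c.baseSet := c.mem_baseSet
  have hπ : ContMDiff IA IB ∞ (π F A) :=
    SmoothAffineBundle.contMDiff_proj (F := F) (E := E) (A := A) (IB := IB) (IA := IA)
  set v₀ := c.coord a with hv₀
  let P₀ := c.partialDeriv f (a.1, v₀)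
  have hV : c.baseSet ×ˢ (Set.univ : Set F) ∈ 𝓝 (a.1, v₀) :=
    (c.isOpen_baseSet.prod isOpen_univ).mem_nhds ⟨ha, trivial⟩
  -- the chart of `A`
  obtain ⟨T, hT, hT'⟩ := exists_hasMFDerivAt_of_local_inverse
    (I := IB.prod 𝓘(ℝ, F)) (J := IA) (g := c.toFun)
    (h := fun b : TotalSpace F A => (b.1, c.coord b)) (x := (a.1, v₀)) (y := a)
    (c.toFun_coord a ha) rfl ((c.contMDiffAt_toFun ha v₀).mdifferentiableAt (by simp))
    ((hπ.contMDiffAt.prodMk (c.contMDiffAt_coord ha)).mdifferentiableAt (by simp))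
    (by
      filter_upwards [hV] with z hz
      exact Prod.ext (c.toFun_fst z.1 hz.1 z.2) (c.coord_toFun z.1 hz.1 z.2))
    (by
      filter_upwards [(c.isOpen_baseSet.preimage hπ.continuous).mem_nhds ha] with b hb
      exact c.toFun_coord b hb)
  -- the chart of `E^*`
  have hsrc : fibreDeriv (E := E) f a ∈ c.dualTrivialization.source :=
    c.dualTrivialization.mem_source.2 (c.mem_dualTrivialization_baseSet ha)
  have hG₀ : c.dualTrivialization (fibreDeriv (E := E) f a) = (a.1, P₀) :=
    c.dualTrivialization_fibreDeriv hf ha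
  have hG₀' : c.dualTrivialization.toOpenPartialHomeomorph.symm (a.1, P₀) =
      fibreDeriv (E := E) f a := by
    rw [← hG₀]
    exact c.dualTrivialization.toOpenPartialHomeomorph.left_inv hsrc
  obtain ⟨S, hS, hS'⟩ := exists_hasMFDerivAt_of_local_inverse
    (I := IB.prod 𝓘(ℝ, F →L[ℝ] ℝ)) (J := IB.prod 𝓘(ℝ, F →L[ℝ] ℝ))
    (g := c.dualTrivialization) (h := c.dualTrivialization.toOpenPartialHomeomorph.symm)
    (x := fibreDeriv (E := E) f a) (y := (a.1, P₀)) hG₀ hG₀'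
    (((c.dualTrivialization.contMDiffOn (IB := IB) (n := ∞)).contMDiffAt
      (c.dualTrivialization.open_source.mem_nhds hsrc)).mdifferentiableAt (by simp))
    ((c.contMDiffAt_dualTrivialization_symm ha P₀).mdifferentiableAt (by simp))
    (by
      filter_upwards [c.dualTrivialization.open_source.mem_nhds hsrc] with z hz
      exact c.dualTrivialization.toOpenPartialHomeomorph.left_inv hz)
    (by
      filter_upwards [c.dualTrivialization.open_target.mem_nhds (c.dualTrivialization.mem_target.2
        (c.mem_dualTrivialization_baseSet ha) : (a.1, P₀) ∈ _)] with z hz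
      exact c.dualTrivialization.toOpenPartialHomeomorph.right_inv hz)
  let G : EA →L[ℝ] EB × (F →L[ℝ] ℝ) :=
    mfderiv IA (IB.prod 𝓘(ℝ, F →L[ℝ] ℝ)) (fibreDeriv (E := E) f) a
  have hG : HasMFDerivAt IA (IB.prod 𝓘(ℝ, F →L[ℝ] ℝ)) (fibreDeriv (E := E) f) a G :=
    ((c.contMDiffAt_fibreDeriv hf ha).mdifferentiableAt (by simp)).hasMFDerivAt
  let P' : EB × F →L[ℝ] (F →L[ℝ] ℝ) :=
    mfderiv (IB.prod 𝓘(ℝ, F)) 𝓘(ℝ, F →L[ℝ] ℝ) (c.partialDeriv f) (a.1, v₀)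
  have hP' : HasMFDerivAt (IB.prod 𝓘(ℝ, F)) 𝓘(ℝ, F →L[ℝ] ℝ) (c.partialDeriv f) (a.1, v₀) P' :=
    ((c.contMDiffAt_partialDeriv hf ha v₀).mdifferentiableAt (by simp)).hasMFDerivAt
  -- Read in the charts of `A` and `E^*`, `𝓕` is `z ↦ (z.1, partialDeriv z)` near the point. `B` and
  -- `D` will be the restrictions of `P'` to the two factors.
  have hSGT : ∀ z, S (G (T z)) = (z.1, P' z) := by
    have hGH : HasMFDerivAt (IB.prod 𝓘(ℝ, F)) (IB.prod 𝓘(ℝ, F →L[ℝ] ℝ))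
        (fibreDeriv (E := E) f ∘ c.toFun) (a.1, v₀) (G ∘L (T : EB × F →L[ℝ] EA)) := by
      have hG' : HasMFDerivAt IA (IB.prod 𝓘(ℝ, F →L[ℝ] ℝ)) (fibreDeriv (E := E) f)
          (c.toFun (a.1, v₀)) G := by
        rw [c.toFun_coord a ha]; exact hG
      exact hG'.comp _ hT
    have hSGH : HasMFDerivAt (IB.prod 𝓘(ℝ, F)) (IB.prod 𝓘(ℝ, F →L[ℝ] ℝ))
        (c.dualTrivialization ∘ fibreDeriv (E := E) f ∘ c.toFun) (a.1, v₀)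
        (S.toContinuousLinearMap ∘L G ∘L (T : EB × F →L[ℝ] EA)) := by
      have hS'' : HasMFDerivAt (IB.prod 𝓘(ℝ, F →L[ℝ] ℝ)) (IB.prod 𝓘(ℝ, F →L[ℝ] ℝ))
          c.dualTrivialization ((fibreDeriv (E := E) f ∘ c.toFun) (a.1, v₀))
          S.toContinuousLinearMap := by
        rw [Function.comp_apply, c.toFun_coord a ha]; exact hS
      exact hS''.comp _ hGH
    have h2 : HasMFDerivAt (IB.prod 𝓘(ℝ, F)) (IB.prod 𝓘(ℝ, F →L[ℝ] ℝ))
        (fun z : M × F => (z.1, c.partialDeriv f z)) (a.1, v₀)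
        ((ContinuousLinearMap.fst ℝ EB F).prod P') :=
      (hasMFDerivAt_fst (a.1, v₀)).prodMk hP'
    have h3 := hasMFDerivAt_unique hSGH (h2.congr_of_eventuallyEq (by
      filter_upwards [hV] with z hz
      have h1 : (c.toFun z).1 = z.1 := c.toFun_fst z.1 hz.1 z.2
      have h4 := c.dualTrivialization_fibreDeriv hf (b := c.toFun z) (by rw [h1]; exact hz.1)
      rw [h1, c.coord_toFun z.1 hz.1 z.2] at h4
      exact h4))
    exact fun z => congrArg (fun k : EB × F →L[ℝ] EB × (F →L[ℝ] ℝ) => k z) h3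
  have hD : P' ∘L ContinuousLinearMap.inr ℝ EB F =
      fderiv ℝ (fun v => c.partialDeriv f (a.1, v)) v₀ := by
    have h1 : HasMFDerivAt 𝓘(ℝ, F) (IB.prod 𝓘(ℝ, F)) (fun v : F => (a.1, v)) v₀
        (ContinuousLinearMap.inr ℝ EB F) :=
      (hasMFDerivAt_const a.1 v₀).prodMk (hasMFDerivAt_id v₀)
    have h2 : HasFDerivAt (fun v => c.partialDeriv f (a.1, v))
      (P' ∘L ContinuousLinearMap.inr ℝ EB F) v₀ := (hP'.comp v₀ h1).hasFDerivAt
    exact h2.fderiv.symm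
  refine ⟨c.linear ha, T, S, P' ∘L ContinuousLinearMap.inl ℝ EB F,
    P' ∘L ContinuousLinearMap.inr ℝ EB F, G, hG, ?_, ?_, ?_, ?_, ?_⟩
  · intro u v
    rw [hSGT]
    refine Prod.ext rfl ?_
    change P' (u, v) = P' (u, 0) + P' (0, v)
    rw [← map_add]
    simp
  · intro e
    have h1 : HasFDerivAt (fun t : ℝ => v₀ + t • c.linear ha e)
        (ContinuousLinearMap.toSpanSingleton ℝ (c.linear ha e)) 0 :=
      (((hasDerivAt_id (0 : ℝ)).smul_const (c.linear ha e)).const_add v₀).hasFDerivAt.congr_fderiv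
        (by ext; simp)
    have h2 : HasMFDerivAt 𝓘(ℝ, ℝ) (IB.prod 𝓘(ℝ, F))
        (fun t : ℝ => (a.1, v₀ + t • c.linear ha e)) 0
        ((0 : ℝ →L[ℝ] EB).prod (ContinuousLinearMap.toSpanSingleton ℝ (c.linear ha e))) :=
      (hasMFDerivAt_const a.1 (0 : ℝ)).prodMk h1.hasMFDerivAt
    have hT0 : HasMFDerivAt (IB.prod 𝓘(ℝ, F)) IA c.toFun (a.1, v₀ + (0 : ℝ) • c.linear ha e)
        (T : EB × F →L[ℝ] EA) := by
      rw [zero_smul, add_zero]; exact hT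
    have h3 := hT0.comp (0 : ℝ) h2
    have h4 : c.toFun ∘ (fun t : ℝ => (a.1, v₀ + t • c.linear ha e)) = fibreLine a e := by
      funext t
      rw [Function.comp_apply, ← map_smul, c.toFun_coord_add ha]
      rfl
    rw [h4] at h3
    have h5 : lineVelocity IA a e = T (0, (1 : ℝ) • c.linear ha e) :=
      congrArg (fun l : ℝ →L[ℝ] EA => l 1) h3.mfderiv
    rw [h5, one_smul]
  · intro e e'
    rw [c.fibreHessian_apply hf ha, ← hv₀, ← hD]
  · intro v v'
    rw [hD]
    exact c.fderiv_partialDeriv_symm hf ha v₀ v v'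
  -- On a vertical vector `(0, β)` the differential of `h` is its derivative along the fibre of
  -- `E^*`, which is evaluation at `γ_h`.
  · intro h l hh hl β
    have h1 : HasMFDerivAt (IB.prod 𝓘(ℝ, F →L[ℝ] ℝ)) 𝓘(ℝ, ℝ) (c.dualRead h) (a.1, P₀)
        (l ∘L S.symm.toContinuousLinearMap) := by
      rw [← hG₀'] at hl
      exact hl.comp _ hS'
    have h2 : HasMFDerivAt 𝓘(ℝ, F →L[ℝ] ℝ) (IB.prod 𝓘(ℝ, F →L[ℝ] ℝ))
        (fun β : F →L[ℝ] ℝ => (a.1, β)) P₀ (ContinuousLinearMap.inr ℝ EB (F →L[ℝ] ℝ)) :=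
      (hasMFDerivAt_const a.1 P₀).prodMk (hasMFDerivAt_id P₀)
    have h3 : HasFDerivAt (fun β => c.dualRead h (a.1, β))
        ((l ∘L S.symm.toContinuousLinearMap) ∘L
          ContinuousLinearMap.inr ℝ EB (F →L[ℝ] ℝ)) P₀ := (h1.comp P₀ h2).hasFDerivAt
    have h4 := c.evalCLE_linear_gammaMap hf ha hh
    have h5 := DFunLike.congr_fun h4 β
    rw [evalCLE_apply, h3.fderiv] at h5
    exact h5.symm

end Pointwise

/-! ### Linear algebra of the block form -/

section LinearAlgebra

variable {ι V W W' X Z : Type*} [Finite ι] [AddCommGroup V] [Module ℝ V] [AddCommGroup W]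
  [Module ℝ W] [AddCommGroup W'] [Module ℝ W'] [AddCommGroup X] [Module ℝ X] [AddCommGroup Z]
  [Module ℝ Z] {G : X →ₗ[ℝ] Z} {T : V × W → X} {S : Z ≃ₗ[ℝ] V × W'} {B : V →ₗ[ℝ] W'}
  {D : W →ₗ[ℝ] W'} {q : W' →ₗ[ℝ] W →ₗ[ℝ] ℝ} {l : ι → Z →ₗ[ℝ] ℝ} {g : ι → W}

/-- Let `G` be `(u, v) ↦ (u, B u + D v)` up to linear isomorphisms. Independent linear forms which
vanish on the range of `G` are determined by their restrictions to the vertical subspace. -/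
theorem linearIndependent_of_vertical
    (hG : ∀ u v, S (G (T (u, v))) = (u, B u + D v)) (hl : LinearIndependent ℝ l)
    (hlG : ∀ μ x, l μ (G x) = 0) (hlS : ∀ μ β, l μ (S.symm (0, β)) = q β (g μ)) :
    LinearIndependent ℝ g := by
  cases nonempty_fintype ι
  rw [Fintype.linearIndependent_iff] at hl ⊢
  intro c hc
  refine hl c (LinearMap.ext fun z => ?_)
  obtain ⟨⟨u, β⟩, rfl⟩ := S.symm.surjective z
  -- Every vector is the sum of one in the range of `G`, where the forms vanish, and a vertical one.
  have hz : S.symm (u, β) = G (T (u, 0)) + S.symm (0, β - B u) := by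
    rw [← S.symm_apply_apply (G (T (u, 0))), hG, ← map_add]
    simp
  have h1 : ∀ μ, l μ (S.symm (u, β)) = q (β - B u) (g μ) := fun μ => by
    rw [hz, map_add, hlG, hlS, zero_add]
  have h2 := congrArg (q (β - B u)) hc
  rw [map_sum, map_zero] at h2
  simpa [h1] using h2

/-- In the situation of `linearIndependent_of_vertical`, if moreover `D` is symmetric and the range
of `G` is the common kernel of the linear forms, then these forms span the kernel of `D`. -/
theorem mem_span_iff_of_vertical (hq : Function.Injective q.flip)
    (hG : ∀ u v, S (G (T (u, v))) = (u, B u + D v)) (hT : Function.Surjective T)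
    (hD : ∀ v w, q (D v) w = q (D w) v)
    (hlG : ∀ μ x, l μ (G x) = 0) (hlS : ∀ μ β, l μ (S.symm (0, β)) = q β (g μ))
    (hker : ∀ z, (∀ μ, l μ z = 0) → ∃ x, G x = z) (w : W) :
    w ∈ Submodule.span ℝ (Set.range g) ↔ ∀ v, q (D w) v = 0 := by
  cases nonempty_fintype ι
  have hG' : ∀ u v, G (T (u, v)) = S.symm (u, B u + D v) := fun u v => by
    rw [← hG, S.symm_apply_apply]
  constructor
  · intro hw v
    rw [hD]
    refine (Submodule.span_le (p := LinearMap.ker (q (D v)))).2 ?_ hw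
    rintro _ ⟨μ, rfl⟩
    -- `T (0, v)` is sent by `G` to the vertical vector `(0, D v)`; since `l μ` kills it, `D v`
    -- pairs to zero with `g μ`.
    have h1 := hG' 0 v
    rw [map_zero, zero_add] at h1
    change q (D v) (g μ) = 0
    rw [← hlS, ← h1, hlG]
  · intro hw
    -- `K` extends the pairing with `w` from vertical vectors to all of `Z`. The correction by `B`
    -- makes its value on `G (T (u, v))` equal to `q (D v) w`, which is `q (D w) v = 0` by symmetry.
    let K : Z →ₗ[ℝ] ℝ := q.flip w ∘ₗ
      (LinearMap.snd ℝ V W' - B ∘ₗ LinearMap.fst ℝ V W') ∘ₗ S.toLinearMap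
    have hK : ∀ u β, K (S.symm (u, β)) = q (β - B u) w := fun u β => by simp [K]
    have hle : ⨅ μ, LinearMap.ker (l μ) ≤ LinearMap.ker K := by
      intro z hz
      rw [Submodule.mem_iInf] at hz
      obtain ⟨x, rfl⟩ := hker z hz
      obtain ⟨⟨u, v⟩, rfl⟩ := hT x
      rw [LinearMap.mem_ker, hG', hK, add_sub_cancel_left, hD, hw]
    obtain ⟨c, hc⟩ := (Submodule.mem_span_range_iff_exists_fun ℝ).1
      (mem_span_of_iInf_ker_le_ker hle)
    -- The coefficients that express `K` through the `l μ` also express `w` through the `g μ`, as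
    -- seen on vertical vectors.
    refine (Submodule.mem_span_range_iff_exists_fun ℝ).2 ⟨c, hq (LinearMap.ext fun β => ?_)⟩
    have h1 := LinearMap.congr_fun hc (S.symm (0, β))
    rw [hK, map_zero, sub_zero] at h1
    simpa [hlS] using h1

theorem linearIndependent_toLinearMap {κ Y : Type*} [NormedAddCommGroup Y] [NormedSpace ℝ Y]
    {l : κ → (Y →L[ℝ] ℝ)} (h : LinearIndependent ℝ l) :
    LinearIndependent ℝ fun μ => (l μ).toLinearMap :=
  h.map' (ContinuousLinearMap.coeLM ℝ) (LinearMap.ker_eq_bot.2 ContinuousLinearMap.coe_injective)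

end LinearAlgebra

/-! ### Kernels, smoothness of `Γ_h`, and the frame -/

section Frames

/-- Points over different base points are separated in the base, points of one fibre in a
trivialization. Applied to `E^*`, this allows the use of bump functions there. -/
theorem t2Space_totalSpace {B : Type*} (F : Type*) (E : B → Type*) [TopologicalSpace B] [T2Space B]
    [TopologicalSpace F] [T2Space F] [∀ x, TopologicalSpace (E x)]
    [TopologicalSpace (TotalSpace F E)] [FiberBundle F E] : T2Space (TotalSpace F E) := by
  refine ⟨fun p q hpq => ?_⟩
  have hπ := FiberBundle.continuous_proj F E
  by_cases h : p.1 = q.1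
  · set e := trivializationAt F E p.1
    have hp : p ∈ e.source := e.mem_source.2 (mem_baseSet_trivializationAt F E p.1)
    have hq : q ∈ e.source := e.mem_source.2 (h ▸ mem_baseSet_trivializationAt F E p.1)
    have hne : (e p).2 ≠ (e q).2 := fun h2 => hpq <| e.injOn hp hq <|
      Prod.ext ((e.coe_fst hp).trans (h.trans (e.coe_fst hq).symm)) h2
    obtain ⟨u, v, hu, hv, hpu, hqv, huv⟩ := t2_separation hne
    have hc : ContinuousOn (fun z => (e z).2) e.source :=
      continuous_snd.comp_continuousOn e.continuousOn_toFun
    refine ⟨_, _, hc.isOpen_inter_preimage e.open_source hu,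
      hc.isOpen_inter_preimage e.open_source hv, ⟨hp, hpu⟩, ⟨hq, hqv⟩, ?_⟩
    exact Set.disjoint_left.2 fun z hz hz' => Set.disjoint_left.1 huv hz.2 hz'.2
  · obtain ⟨u, v, hu, hv, hpu, hqv, huv⟩ := t2_separation h
    exact ⟨_, _, hu.preimage hπ, hv.preimage hπ, hpu, hqv, huv.preimage _⟩

variable {EB HB M EA HA F : Type*} {E A : M → Type*}
  [NormedAddCommGroup EB] [NormedSpace ℝ EB] [TopologicalSpace HB]
  {IB : ModelWithCorners ℝ EB HB} [TopologicalSpace M] [ChartedSpace HB M]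
  [NormedAddCommGroup F] [NormedSpace ℝ F]
  [∀ x, AddCommGroup (E x)] [∀ x, Module ℝ (E x)] [∀ x, TopologicalSpace (E x)]
  [TopologicalSpace (TotalSpace F E)] [FiberBundle F E] [VectorBundle ℝ F E]
  [ContMDiffVectorBundle ∞ F E IB]
  [NormedAddCommGroup EA] [NormedSpace ℝ EA] [TopologicalSpace HA]
  {IA : ModelWithCorners ℝ EA HA}
  [TopologicalSpace (TotalSpace F A)] [ChartedSpace HA (TotalSpace F A)]
  [∀ x, AddTorsor (E x) (A x)] [SmoothAffineBundle F E A IB IA]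
  {f : TotalSpace F A → ℝ}

theorem mem_kerHessianOp {a : TotalSpace F A} {w : TangentSpace IA a} :
    w ∈ kerHessianOp (E := E) IB IA f a ↔
      ∃ e : E a.1, (∀ e', fibreHessian f a e e' = 0) ∧ lineVelocity IA a e = w := by
  constructor
  · rintro ⟨v, hv, rfl⟩
    refine ⟨(vertLift IB IA a).symm v, fun e' => ?_, ?_⟩
    · have h := hessianOp_apply IB IA f a v (vertLift IB IA a e')
      rw [LinearEquiv.symm_apply_apply] at h
      rw [← h, LinearMap.mem_ker.1 hv, LinearMap.zero_apply]
    · rw [← vertLift_apply IB IA, LinearEquiv.apply_symm_apply]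
      rfl
  · rintro ⟨e, he, rfl⟩
    refine ⟨vertLift IB IA a e, LinearMap.mem_ker.2 (LinearMap.ext fun v => ?_),
      vertLift_apply IB IA a e⟩
    rw [hessianOp_apply, LinearEquiv.symm_apply_apply, he, LinearMap.zero_apply]

theorem gammaField_eq_lineVelocity [FiniteDimensional ℝ F] (f : TotalSpace F A → ℝ) (h : DualSpace F E → ℝ)
    (a : TotalSpace F A) :
    gammaField IB IA f h a = lineVelocity IA a (gammaMap f h a) :=
  vertLift_apply IB IA a _

variable [IsManifold IB ∞ M]

theorem contMDiff_fibreDeriv (hf : ContMDiff IA 𝓘(ℝ, ℝ) ∞ f) :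
    ContMDiff IA (IB.prod 𝓘(ℝ, F →L[ℝ] ℝ)) ∞ (fibreDeriv (E := E) f) := fun a => by
  obtain ⟨c⟩ := nonempty_fibreChart F E A IB IA a.1
  exact c.contMDiffAt_fibreDeriv hf c.mem_baseSet

/-- The composite `φ μ ∘ 𝓕` vanishes identically near `a`, because `φ μ` is zero on the part of the
image of `𝓕` in `U`. -/
theorem mvfderiv_comp_eq_zero {k : ℕ} {φ : Fin k → DualSpace F E → ℝ} {U : Set (DualSpace F E)}
    (hf : ContMDiff IA 𝓘(ℝ, ℝ) ∞ f)
    (hφ : DefinesOn (IB.prod 𝓘(ℝ, F →L[ℝ] ℝ)) φ (Set.range (fibreDeriv (E := E) f)) U)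
    {a : TotalSpace F A} (ha : fibreDeriv (E := E) f a ∈ U) (μ : Fin k)
    {l : EB × (F →L[ℝ] ℝ) →L[ℝ] ℝ} {G : EA →L[ℝ] EB × (F →L[ℝ] ℝ)}
    (hl : HasMFDerivAt (IB.prod 𝓘(ℝ, F →L[ℝ] ℝ)) 𝓘(ℝ, ℝ) (φ μ) (fibreDeriv (E := E) f a) l)
    (hG : HasMFDerivAt IA (IB.prod 𝓘(ℝ, F →L[ℝ] ℝ)) (fibreDeriv (E := E) f) a G) (w : EA) :
    l (G w) = 0 := by
  have h1 := hl.comp a hG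
  have h2 : φ μ ∘ fibreDeriv (E := E) f =ᶠ[𝓝 a] fun _ => (0 : ℝ) := by
    filter_upwards [(hφ.isOpen.preimage
      (contMDiff_fibreDeriv (E := E) (IB := IB) hf).continuous).mem_nhds ha] with b hb
    have h3 : fibreDeriv (E := E) f b ∈ {p ∈ U | ∀ μ, φ μ p = 0} :=
      hφ.inter_eq ▸ ⟨⟨b, rfl⟩, hb⟩
    exact h3.2 μ
  have h4 := hasMFDerivAt_unique h1 ((hasMFDerivAt_const (0 : ℝ) a).congr_of_eventuallyEq h2)
  exact congrArg (fun k : EA →L[ℝ] ℝ => k w) h4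

variable [FiniteDimensional ℝ F]

/-- The kernel of the hessian operator is the kernel of the tangent map of the fibre derivative. -/
theorem kerHessianOp_eq_kerTangentFibreDeriv (hf : ContMDiff IA 𝓘(ℝ, ℝ) ∞ f)
    (a : TotalSpace F A) :
    kerHessianOp (E := E) IB IA f a = kerTangentFibreDeriv (E := E) IB IA f a := by
  obtain ⟨L, T, S, B, D, G, hG, hSGT, hvel, hhess, -, -⟩ :=
    exists_derivative_of_fibreDeriv (E := E) (IB := IB) hf a
  ext w
  have hw : w ∈ kerTangentFibreDeriv (E := E) IB IA f a ↔ G w = 0 := by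
    rw [← hG.mfderiv]; rfl
  rw [mem_kerHessianOp, hw]
  constructor
  · rintro ⟨e, he, rfl⟩
    have hDe : D (L e) = 0 := by
      ext v
      obtain ⟨e', rfl⟩ := L.surjective v
      rw [← hhess, he]
      rfl
    apply S.injective
    rw [hvel, hSGT, hDe]
    simp
  · intro hGw
    obtain ⟨⟨u, v⟩, huv⟩ := T.surjective w
    have h1 : (u, B u + D v) = 0 := by
      rw [← hSGT]
      exact (congrArg (fun y => S (G y)) huv).trans ((congrArg S hGw).trans S.map_zero)
    -- `𝓕` covers the identity of `M`, so the kernel of its tangent map is automatically vertical.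
    have hu : u = 0 := congrArg Prod.fst h1
    have hv : D v = 0 := by
      have := congrArg Prod.snd h1
      simpa [hu] using this
    refine ⟨L.symm v, fun e' => ?_, ?_⟩
    · rw [hhess, L.apply_symm_apply, hv]
      rfl
    · rw [hvel, L.apply_symm_apply, ← hu]
      exact huv

set_option synthInstance.maxHeartbeats 200000 in
/-- If `h` is smooth near `𝓕 a`, then the vector field `Γ_h` is smooth near `a`. -/
theorem contMDiffAt_gammaField [IsManifold IA ∞ (TotalSpace F A)]
    (hf : ContMDiff IA 𝓘(ℝ, ℝ) ∞ f) {U : Set (DualSpace F E)} (hU : IsOpen U)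
    {h : DualSpace F E → ℝ} (hh : ContMDiffOn (IB.prod 𝓘(ℝ, F →L[ℝ] ℝ)) 𝓘(ℝ, ℝ) ∞ h U)
    {a : TotalSpace F A} (ha : fibreDeriv (E := E) f a ∈ U) :
    ContMDiffAt IA IA.tangent ∞
      (fun b => (⟨b, gammaField IB IA f h b⟩ : TangentBundle IA (TotalSpace F A))) a := by
  obtain ⟨c⟩ := nonempty_fibreChart F E A IB IA a.1
  have hac : a.1 ∈ c.baseSet := c.mem_baseSet
  have hπ : ContMDiff IA IB ∞ (π F A) :=
    SmoothAffineBundle.contMDiff_proj (F := F) (E := E) (A := A) (IB := IB) (IA := IA)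
  have hhU : ∀ q ∈ U, ContMDiffAt (IB.prod 𝓘(ℝ, F →L[ℝ] ℝ)) 𝓘(ℝ, ℝ) ∞ h q :=
    fun q hq => hh.contMDiffAt (hU.mem_nhds hq)
  let γ : TotalSpace F A → F := fun b => (evalCLE F).symm
    (fderiv ℝ (fun β => c.dualRead h (b.1, β)) (c.partialDeriv f (b.1, c.coord b)))
  have hcoord := c.contMDiffAt_coord hac
  have hγ : ContMDiffAt IA 𝓘(ℝ, F) ∞ γ a := by
    have h1 := c.contMDiffAt_dualRead hac (α := fibreDerivAt f a) (hhU _ ha)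
    rw [c.dual_fibreDerivAt hf hac] at h1
    have h2 : ContMDiffAt IA (IB.prod 𝓘(ℝ, F →L[ℝ] ℝ)) ∞
        (fun b : TotalSpace F A => (b.1, c.partialDeriv f (b.1, c.coord b))) a :=
      hπ.contMDiffAt.prodMk (ContMDiffAt.comp a (c.contMDiffAt_partialDeriv hf hac (c.coord a))
        (hπ.contMDiffAt.prodMk hcoord))
    exact (evalCLE F).symm.toContinuousLinearMap.contMDiff.contMDiffAt.comp a
      (ContMDiffAt.comp a (contMDiffAt_fderiv_snd h1) h2)
  -- For `b` near `a`, `Φ b` is the line through `b` in the direction `γ_h b`. The field is the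
  -- `t`-derivative at `0` of this smooth family, so smoothness of parametrized derivatives applies.
  let Φ : TotalSpace F A → ℝ → TotalSpace F A := fun b t => c.toFun (b.1, c.coord b + t • γ b)
  have hΦ : ContMDiffAt (IA.prod 𝓘(ℝ, ℝ)) IA ∞ (Function.uncurry Φ) (a, 0) := by
    have h1 : ContMDiffAt (IA.prod 𝓘(ℝ, ℝ)) (IB.prod 𝓘(ℝ, F)) ∞
        (fun z : TotalSpace F A × ℝ => (z.1.1, c.coord z.1 + z.2 • γ z.1)) (a, 0) :=
      (hπ.contMDiffAt.comp (a, (0 : ℝ)) contMDiffAt_fst).prodMk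
        ((ContMDiffAt.comp (a, (0 : ℝ)) hcoord contMDiffAt_fst).add
          (contMDiffAt_snd.smul (ContMDiffAt.comp (g := γ) (a, (0 : ℝ)) hγ contMDiffAt_fst)))
    exact ContMDiffAt.comp (a, (0 : ℝ)) (c.contMDiffAt_toFun hac _) h1
  have hΦ0 : ContMDiffAt IA IA ∞ (fun b => Φ b 0) a :=
    ContMDiffAt.comp (g := Function.uncurry Φ) (f := fun b => (b, (0 : ℝ))) a hΦ
      (contMDiffAt_id.prodMk contMDiffAt_const)
  have h3 := ContMDiffAt.mfderiv Φ (fun _ => (0 : ℝ)) hΦ contMDiffAt_const (m := ∞) (by simp)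
  have h4 := ContMDiffAt.clm_apply_of_inCoordinates (IM := IA) (IB₁ := 𝓘(ℝ, ℝ)) (IB₂ := IA)
    (b₁ := fun _ : TotalSpace F A => (0 : ℝ)) (b₂ := fun b => Φ b 0)
    (E₁ := TangentSpace 𝓘(ℝ, ℝ)) (E₂ := TangentSpace IA)
    (ϕ := fun b => mfderiv 𝓘(ℝ, ℝ) IA (Φ b) 0) (v := fun _ => (1 : ℝ)) h3 contMDiffAt_const hΦ0
  refine h4.congr_of_eventuallyEq ?_
  filter_upwards [(c.isOpen_baseSet.preimage hπ.continuous).mem_nhds hac,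
    (hU.preimage (contMDiff_fibreDeriv (E := E) (IB := IB) hf).continuous).mem_nhds ha] with b hb hbU
  have hγb : γ b = c.linear hb (gammaMap f h b) := by
    rw [← (evalCLE F).symm_apply_apply (c.linear hb (gammaMap f h b)),
      c.evalCLE_linear_gammaMap hf hb (hhU _ hbU)]
  have hΦb : Φ b = fibreLine b (gammaMap f h b) := by
    funext t
    change c.toFun (b.1, c.coord b + t • γ b) = _
    rw [hγb, ← map_smul, c.toFun_coord_add hb]
    rfl
  rw [gammaField_eq_lineVelocity]
  have hΦb0 : b = Φ b 0 := by
    rw [hΦb]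
    simp [fibreLine]
  -- `Φ b 0` equals `b` only propositionally, so the base point of the tangent vector has to be
  -- rewritten; the vector itself stays in the model space `EA`.
  have hcast : ∀ (y : TotalSpace F A) (_ : b = y) (w : EA),
      (⟨b, w⟩ : TangentBundle IA (TotalSpace F A)) = ⟨y, w⟩ := by
    rintro y rfl w
    rfl
  refine (hcast _ hΦb0 (lineVelocity IA b (gammaMap f h b))).trans ?_
  rw [lineVelocity, ← hΦb]

/-- The values at `a` of the vector fields `Γ_φ`, for independent functions `φ` defining the image
of the fibre derivative, are a basis of the kernel of the hessian operator. -/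
theorem linearIndependent_gammaField_and_span_eq [FiniteDimensional ℝ EB] [IB.Boundaryless]
    [IA.Boundaryless] (hf : ContMDiff IA 𝓘(ℝ, ℝ) ∞ f)
    (hreg : IsSubmersionOntoClosedSubmanifold IA (IB.prod 𝓘(ℝ, F →L[ℝ] ℝ))
      (fibreDeriv (E := E) f)) {k : ℕ} {φ : Fin k → DualSpace F E → ℝ} {U : Set (DualSpace F E)}
    (hφ : DefinesOn (IB.prod 𝓘(ℝ, F →L[ℝ] ℝ)) φ (Set.range (fibreDeriv (E := E) f)) U)
    {a : TotalSpace F A} (ha : fibreDeriv (E := E) f a ∈ U) :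
    (LinearIndependent ℝ fun μ => gammaField IB IA f (φ μ) a) ∧
      Submodule.span ℝ (Set.range fun μ => gammaField IB IA f (φ μ) a) =
        kerHessianOp (E := E) IB IA f a := by
  obtain ⟨L, T, S, B, D, G, hG, hSGT, hvel, hhess, hsymm, hdual⟩ :=
    exists_derivative_of_fibreDeriv (E := E) (IB := IB) hf a
  let l : Fin k → (EB × (F →L[ℝ] ℝ) →L[ℝ] ℝ) := fun μ =>
    mfderiv (IB.prod 𝓘(ℝ, F →L[ℝ] ℝ)) 𝓘(ℝ, ℝ) (φ μ) (fibreDeriv (E := E) f a)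
  have hφa : ∀ μ, ContMDiffAt (IB.prod 𝓘(ℝ, F →L[ℝ] ℝ)) 𝓘(ℝ, ℝ) ∞ (φ μ)
      (fibreDeriv (E := E) f a) :=
    fun μ => (hφ.contMDiffOn μ).contMDiffAt (hφ.isOpen.mem_nhds ha)
  have hl : ∀ μ, HasMFDerivAt (IB.prod 𝓘(ℝ, F →L[ℝ] ℝ)) 𝓘(ℝ, ℝ) (φ μ)
      (fibreDeriv (E := E) f a) (l μ) :=
    fun μ => ((hφa μ).mdifferentiableAt (by simp)).hasMFDerivAt
  have hlm : ∀ μ, mvfderiv (IB.prod 𝓘(ℝ, F →L[ℝ] ℝ)) (φ μ) (fibreDeriv (E := E) f a) = l μ :=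
    fun μ => mvfderiv_eq_of_hasMFDerivAt (hl μ)
  let l' : Fin k → (EB × (F →L[ℝ] ℝ) →ₗ[ℝ] ℝ) := fun μ => (l μ).toLinearMap
  have hli : LinearIndependent ℝ l' := by
    have h1 : LinearIndependent ℝ l := by
      have h2 := hφ.linearIndependent _ ⟨⟨a, rfl⟩, ha⟩
      rw [funext hlm] at h2
      exact h2
    exact linearIndependent_toLinearMap (Y := EB × (F →L[ℝ] ℝ)) h1
  let g : Fin k → F := fun μ => L (gammaMap f (φ μ) a)
  let q : (F →L[ℝ] ℝ) →ₗ[ℝ] F →ₗ[ℝ] ℝ := ContinuousLinearMap.coeLM ℝ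
  have hq : Function.Injective q.flip := fun v w hvw =>
    (evalCLE F).injective (ContinuousLinearMap.ext fun β => LinearMap.congr_fun hvw β)
  have hlS : ∀ μ β, l' μ (S.symm.toLinearEquiv (0, β)) = q β (g μ) := fun μ β =>
    hdual (φ μ) (l μ) (hφa μ) (hl μ) β
  have hlG : ∀ μ w, l' μ (G.toLinearMap w) = 0 := fun μ w =>
    mvfderiv_comp_eq_zero hf hφ ha μ (hl μ) hG w
  -- This is where the submersion hypothesis enters: every common zero of the differentials is a
  -- value of the tangent map of `𝓕`.
  have hker : ∀ z, (∀ μ, l' μ z = 0) → ∃ x, G.toLinearMap x = z := fun z hz =>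
    hreg.mem_range_of_mvfderiv_eq_zero hG hφ ha (w := z) fun μ =>
      (congrArg (fun k : EB × (F →L[ℝ] ℝ) →L[ℝ] ℝ => k z) (hlm μ)).trans (hz μ)
  -- The map `v ↦ T (0, v)` is the vertical lift in coordinates. It is injective, so it carries the
  -- independence and the span of the `g μ` in `F` to the vector fields.
  let j : F →ₗ[ℝ] EA := T.toLinearMap ∘ₗ LinearMap.inr ℝ EB F
  let i : F →ₗ[ℝ] TangentSpace IA a := j
  have hi : LinearMap.ker i = ⊥ :=
    LinearMap.ker_eq_bot.2 (T.injective.comp LinearMap.inr_injective)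
  have hΓ : (fun μ => gammaField IB IA f (φ μ) a) = i ∘ g := funext fun μ => by
    rw [gammaField_eq_lineVelocity, hvel]
    rfl
  rw [hΓ]
  constructor
  · exact (linearIndependent_of_vertical (S := S.toLinearEquiv) (B := B.toLinearMap)
      (D := D.toLinearMap) hSGT hli hlG hlS).map' i hi
  · have hspan := mem_span_iff_of_vertical (S := S.toLinearEquiv) (B := B.toLinearMap)
      (D := D.toLinearMap) hq hSGT T.surjective hsymm hlG hlS hker
    rw [Set.range_comp, Submodule.span_image]
    ext w
    rw [mem_kerHessianOp]
    constructor
    · rintro ⟨v, hv, rfl⟩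
      refine ⟨L.symm v, fun e' => ?_, ?_⟩
      · rw [hhess, L.apply_symm_apply]
        exact (hspan v).1 hv _
      · rw [hvel, L.apply_symm_apply]
        rfl
    · rintro ⟨e, he, rfl⟩
      refine ⟨L e, (hspan _).2 fun v => ?_, (hvel e).symm⟩
      obtain ⟨e', rfl⟩ := L.surjective v
      exact (hhess e e').symm.trans (he e')

end Frames

end FibreDerivative

end

theorem proposition3
    {EB HB M EA HA F : Type*} {E A : M → Type*}
    -- the base manifold `M`
    [NormedAddCommGroup EB] [NormedSpace ℝ EB] [FiniteDimensional ℝ EB] [TopologicalSpace HB]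
    (IB : ModelWithCorners ℝ EB HB) [IB.Boundaryless]
    [TopologicalSpace M] [T2Space M] [ChartedSpace HB M] [IsManifold IB ∞ M]
    -- the vector bundle `E → M`
    [NormedAddCommGroup F] [NormedSpace ℝ F] [FiniteDimensional ℝ F]
    [∀ x, AddCommGroup (E x)] [∀ x, Module ℝ (E x)] [∀ x, TopologicalSpace (E x)]
    [TopologicalSpace (TotalSpace F E)] [FiberBundle F E] [VectorBundle ℝ F E]
    [ContMDiffVectorBundle ∞ F E IB]
    -- the affine bundle `A → M` modelled on `E`
    [NormedAddCommGroup EA] [NormedSpace ℝ EA] [FiniteDimensional ℝ EA] [TopologicalSpace HA]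
    (IA : ModelWithCorners ℝ EA HA) [IA.Boundaryless]
    [TopologicalSpace (TotalSpace F A)] [ChartedSpace HA (TotalSpace F A)]
    [IsManifold IA ∞ (TotalSpace F A)]
    [∀ x, AddTorsor (E x) (A x)] [FibreDerivative.SmoothAffineBundle F E A IB IA]
    -- the almost regular function `f : A → ℝ`
    (f : TotalSpace F A → ℝ) (hf : ContMDiff IA 𝓘(ℝ, ℝ) ∞ f)
    (hreg : FibreDerivative.AlmostRegular E IB IA f) :
    -- `Ker Ŵ = Ker T𝓕`
    (∀ a : TotalSpace F A, FibreDerivative.kerHessianOp (E := E) IB IA f a =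
      FibreDerivative.kerTangentFibreDeriv (E := E) IB IA f a) ∧
    -- `𝓕(A)` is locally defined by the vanishing of independent functions
    (∀ p ∈ Set.range (FibreDerivative.fibreDeriv (E := E) f),
      ∃ (U : Set (FibreDerivative.DualSpace F E)) (k : ℕ)
        (φ : Fin k → FibreDerivative.DualSpace F E → ℝ),
        p ∈ U ∧
        (∀ μ, ContMDiff (IB.prod 𝓘(ℝ, F →L[ℝ] ℝ)) 𝓘(ℝ, ℝ) ∞ (φ μ)) ∧
        (∀ q ∈ U, LinearIndependent ℝ fun μ =>
          mvfderiv (IB.prod 𝓘(ℝ, F →L[ℝ] ℝ)) (φ μ) q) ∧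
        FibreDerivative.DefinesOn (IB.prod 𝓘(ℝ, F →L[ℝ] ℝ)) φ
          (Set.range (FibreDerivative.fibreDeriv (E := E) f)) U) ∧
    -- for any such functions `φ_μ`, the fields `Γ_{φ_μ}` are a frame of `Ker Ŵ`
    (∀ (U : Set (FibreDerivative.DualSpace F E)) (k : ℕ)
      (φ : Fin k → FibreDerivative.DualSpace F E → ℝ),
      FibreDerivative.DefinesOn (IB.prod 𝓘(ℝ, F →L[ℝ] ℝ)) φ
        (Set.range (FibreDerivative.fibreDeriv (E := E) f)) U →
      FibreDerivative.IsFrameOn IA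
        (fun μ => FibreDerivative.gammaField IB IA f (φ μ))
        (FibreDerivative.kerHessianOp (E := E) IB IA f)
        (FibreDerivative.fibreDeriv (E := E) f ⁻¹' U)) := by
  have := FibreDerivative.t2Space_totalSpace (F →L[ℝ] ℝ)
    (fun x => E x →L[ℝ] Trivial M ℝ x)
  refine ⟨fun a => FibreDerivative.kerHessianOp_eq_kerTangentFibreDeriv hf a, ?_,
    fun U k φ hφ => ⟨fun μ a ha => ?_, fun a ha => ?_, fun a ha => ?_⟩⟩
  · rintro _ ⟨a, rfl⟩
    exact hreg.isSubmersionOnto.exists_definesOn (FibreDerivative.contMDiff_fibreDeriv hf) a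
  · exact (FibreDerivative.contMDiffAt_gammaField hf hφ.isOpen
      (hφ.contMDiffOn μ) ha).contMDiffWithinAt
  · exact (FibreDerivative.linearIndependent_gammaField_and_span_eq hf hreg.isSubmersionOnto
      hφ ha).1
  · exact (FibreDerivative.linearIndependent_gammaField_and_span_eq hf hreg.isSubmersionOnto
      hφ ha).2
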